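/- Let $\Omega\subset\mathbb R^N$ be a bounded connected open set with Lipschitz boundary, and let $D\subset\Omega$ be a Borel set with non-empty interior such that $|\Omega\setminus D|>0$. Let $\lambda,\mu>0$, $p\in[1,\infty)$, let $e\in\mathbb R^M$ with $|e|=1$, let $L:\mathbb R\to\mathbb R$ be any continuous function, and let $f\in L^p(\Omega;\mathbb R^M)$. For $u\in BV(\Omega;\mathbb R^M)$ put $$\mathcal F(u):=|Du|(\Omega)+\lambda\int_{\Omega\setminus D}|u-f|^p\,dx+\mu\int_D\bigl|L(u\cdot e)-L(f\cdot e)\bigr|^p\,dx\in[0,+\infty],$$ where $$|Du|(\Omega)=\sup\Bigl\{\int_\Omega u\cdot\operatorname{div}\varphi\,dx:\varphi\in[C_c^\infty(\Omega;\mathbb R^N)]^M,\ |\varphi|\le 1\Bigr\},$$ and $BV(\Omega;\mathbb R^M)$ is the set of all $u\in L^1(\Omega;\mathbb R^M)$ with $|Du|(\Omega)<\infty$. Then the minimization problem $$\min_{u\in BV(\Omega;\mathbb R^M)}\mathcal F(u)$$ has a solution: there exists $u\in BV(\Omega;\mathbb R^M)$ with $\mathcal F(u)\le\mathcal F(v)$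 for all $v\in BV(\Omega;\mathbb R^M)$. -/

import Mathlib

open scoped ContDiff

/-- `ℝⁿ` with the Euclidean norm. -/
abbrev Euc (n : ℕ) : Type := EuclideanSpace ℝ (Fin n)

/-- The set `Ω` has Lipschitz boundary: near each boundary point `x`, for a suitable unit vector
`ν`, `Ω` is the region lying strictly above the graph of a Lipschitz function `g` over the
hyperplane orthogonal to `ν`, the direction `ν` being "up".
The point `y - ⟪ν, y⟫ ν` is the orthogonal projection of `y` to that hyperplane, so only the values
of `g` on the hyperplane matter. -/
def HasLipschitzBoundary {N : ℕ} (Ω : Set (Euc N)) : Prop :=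
  ∀ x ∈ frontier Ω, ∃ (ν : Euc N) (g : Euc N → ℝ) (K : NNReal) (r : ℝ),
    ‖ν‖ = 1 ∧ LipschitzWith K g ∧ 0 < r ∧
      ∀ y ∈ Metric.ball x r, y ∈ Ω ↔ g (y - inner ℝ ν y • ν) < inner ℝ ν y

/-- The divergence `∑ⱼ ∂ⱼ ψⱼ` of a vector field `ψ` on `ℝᴺ`. -/
noncomputable def divergence {N : ℕ} (ψ : Euc N → Euc N) (x : Euc N) : ℝ :=
  ∑ j : Fin N, fderiv ℝ ψ x (EuclideanSpace.single j 1) j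

/-- `φ = (φ₁, …, φ_M) ∈ [C_c^∞(A; ℝᴺ)]ᴹ` with `|φ| ≤ 1` everywhere, where `|φ(x)|` is the
Euclidean norm of the `M × N` array `φ(x)`. -/
structure IsTestField {N M : ℕ} (A : Set (Euc N)) (φ : Fin M → Euc N → Euc N) : Prop where
  smooth : ∀ i, ContDiff ℝ ∞ (φ i)
  compact_support : ∀ i, HasCompactSupport (φ i)
  support_subset : ∀ i, tsupport (φ i) ⊆ A
  norm_le_one : ∀ x, ∑ i, ‖φ i x‖ ^ 2 ≤ 1

/-- The total variation `|Du|(A) = sup { ∫_A u · div φ }` over test fields `φ` with `|φ| ≤ 1`.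
The set of test fields is symmetric and contains `0`, so cutting the integrals off at `0` does not
change the supremum. -/
noncomputable def totalVar {N M : ℕ} (A : Set (Euc N)) (u : Euc N → Euc M) : ENNReal :=
  ⨆ (φ : Fin M → Euc N → Euc N) (_ : IsTestField A φ),
    ENNReal.ofReal (∫ x in A, ∑ i, u x i * divergence (φ i) x)

/-- `u ∈ BV(A; ℝᴹ)`: `u ∈ L¹(A; ℝᴹ)` and `|Du|(A) < ∞`. -/
def IsBV {N M : ℕ} (A : Set (Euc N)) (u : Euc N → Euc M) : Prop :=
  MeasureTheory.IntegrableOn u A MeasureTheory.volume ∧ totalVar A u < ⊤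

/-- The functional
`F(u) = |Du|(Ω) + lam ∫_{Ω \ D} |u - f|ᵖ dx + mu ∫_D |L(u·e) - L(f·e)|ᵖ dx ∈ [0, ∞]`. -/
noncomputable def colorFunctional {N M : ℕ} (Ω D : Set (Euc N)) (lam mu p : ℝ) (e : Euc M)
    (L : ℝ → ℝ) (f u : Euc N → Euc M) : ENNReal :=
  totalVar Ω u
    + ENNReal.ofReal lam * (∫⁻ x in Ω \ D, ‖u x - f x‖ₑ ^ p)
    + ENNReal.ofReal mu * (∫⁻ x in D, ‖L (inner ℝ (u x) e) - L (inner ℝ (f x) e)‖ₑ ^ p)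

/-! The proof is the direct method; the issues are coercivity and compactness. Since `L` is
arbitrary, the term on `D` gives no bound on `u`. The term on `Ω \ D` bounds the `L¹` norm there,
and `exists_setLIntegral_enorm_le`, a Poincaré inequality for a non-null subset, extends the bound
to `Ω`. It rests on `setLIntegral_enorm_translate_sub_le`: moving `u` by `h` inside `Ω` costs at
most `|h| |Du|(Ω)` in `L¹`. Hence an `L¹` bound near one point passes to nearby points, through `Ω`
by connectedness and up to the boundary by an inward shift in a Lipschitz chart; compactness of the
closure leaves finitely many balls. For compactness no extension operator is used. With `d` the
distance to the complement of `Ω`, the functions `d u_n` have a common linear translation modulus on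
all of `ℝᴺ`, so a Kolmogorov criterion applies. Division by `d` gives a.e. convergence in `Ω` along
a subsequence, and the weighted `L¹` convergence suffices for lower semicontinuity of the total
variation, because `|div φ| ≤ C d` for a field `φ` compactly supported in `Ω`. The two integral
terms pass to the limit by Fatou's lemma and continuity of `L`. -/

/-! ### Duality in `L¹` and the translation estimate. -/

open MeasureTheory Filter Topology Set in
/-- Duality: the `L¹` norm on a compact subset of `A` is bounded by testing against smooth fields
of norm at most one with compact support in `A`. -/
theorem setIntegral_norm_le_of_forall_smooth {N M : ℕ} {A K : Set (Euc N)} (hA : IsOpen A)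
    (hK : IsCompact K) (hKA : K ⊆ A) {g : Euc N → Euc M} (hg : Integrable g) {C : ℝ}
    (h : ∀ ψ : Euc N → Euc M, ContDiff ℝ ∞ ψ → HasCompactSupport ψ → tsupport ψ ⊆ A →
      (∀ x, ‖ψ x‖ ≤ 1) → ∫ x, inner ℝ (g x) (ψ x) ≤ C) :
    ∫ x in K, ‖g x‖ ≤ C := by
  obtain ⟨δ, hδ, hδA⟩ := hK.exists_cthickening_subset_open hA hKA
  -- The optimal but discontinuous field `g / |g|` on `K`, equal to `0` where `g` vanishes because
  -- `0⁻¹ = 0`. Its mollifications are admissible: averaging keeps the norm at most `1`, and the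
  -- supports stay within `δ` of `K`.
  set σ : Euc N → Euc M := K.indicator fun x => ‖g x‖⁻¹ • g x with hσ
  have hσ1 : ∀ x, ‖σ x‖ ≤ 1 := fun x => by
    by_cases hx : x ∈ K
    · rw [hσ, indicator_of_mem hx, norm_smul, norm_inv, norm_norm]
      exact inv_mul_le_one
    · rw [hσ, indicator_of_notMem hx]; simp
  have hσm : AEStronglyMeasurable σ volume := by
    refine AEStronglyMeasurable.indicator ?_ hK.measurableSet
    exact (hg.aestronglyMeasurable.norm.aemeasurable.inv).aestronglyMeasurable.smul
      hg.aestronglyMeasurable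
  have hσi : Integrable σ := by
    have : Integrable (K.indicator fun _ : Euc N => (1 : ℝ)) :=
      (integrable_indicator_iff hK.measurableSet).2 (integrableOn_const hK.measure_lt_top.ne)
    refine this.mono' hσm (ae_of_all _ fun x => ?_)
    by_cases hx : x ∈ K
    · rw [indicator_of_mem hx]; exact hσ1 x
    · rw [hσ, indicator_of_notMem hx, indicator_of_notMem hx]; simp
  -- The fixed ratio `2` of the radii is what the a.e. convergence theorem for mollifiers requires.
  let b : ℕ → ContDiffBump (0 : Euc N) := fun n =>
    ⟨δ / (n + 1) / 2, δ / (n + 1), by positivity, by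
      have : 0 < δ / ((n : ℝ) + 1) := by positivity
      linarith⟩
  have hb0 : Tendsto (fun n => (b n).rOut) atTop (𝓝 0) :=
    tendsto_const_div_atTop_nhds_zero_nat δ |>.comp (tendsto_add_atTop_nat 1) |>.congr fun n => by
      simp [b]
  have hbδ : ∀ n, (b n).rOut ≤ δ := fun n => by
    have : (0 : ℝ) ≤ n := n.cast_nonneg
    exact div_le_self hδ.le (by linarith)
  have hlim := ContDiffBump.ae_convolution_tendsto_right_of_locallyIntegrable (μ := volume)
    (φ := b) (K := 2) hb0 (Eventually.of_forall fun n => by simp only [b]; linarith)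
    hσi.locallyIntegrable
  set ψ : ℕ → Euc N → Euc M := fun n =>
    convolution ((b n).normed volume) σ (ContinuousLinearMap.lsmul ℝ ℝ) volume with hψ
  have hψs : ∀ n, ContDiff ℝ ∞ (ψ n) := fun n =>
    (b n).hasCompactSupport_normed.contDiff_convolution_left _ (b n).contDiff_normed
      hσi.locallyIntegrable
  have hψ1 : ∀ n x, ‖ψ n x‖ ≤ 1 := fun n x => by
    rw [← dist_zero_right]
    exact dist_convolution_le zero_le_one ((b n).support_normed_eq (μ := volume)).subset
      (b n).nonneg_normed (b n).integral_normed hσm fun y _ => by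
        rw [dist_zero_right]; exact hσ1 y
  have hψt : ∀ n, tsupport (ψ n) ⊆ Metric.cthickening δ K := fun n => by
    refine closure_minimal ((support_convolution_subset _).trans ?_) Metric.isClosed_cthickening
    rintro _ ⟨x, hx, y, hy, rfl⟩
    rw [(b n).support_normed_eq] at hx
    have hyK : y ∈ K := by
      by_contra hyK
      exact hy (indicator_of_notMem hyK _)
    refine Metric.mem_cthickening_of_dist_le (x + y) y δ K hyK ?_
    have := mem_ball_zero_iff.1 hx
    simp only [dist_add_self_left]
    exact this.le.trans (hbδ n)
  have hle : ∀ n, ∫ x, inner ℝ (g x) (ψ n x) ≤ C := fun n =>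
    h _ (hψs n) (hK.cthickening.of_isClosed_subset (isClosed_tsupport _) (hψt n))
      ((hψt n).trans hδA) (hψ1 n)
  have hT : Tendsto (fun n => ∫ x, inner ℝ (g x) (ψ n x)) atTop
      (𝓝 (∫ x, inner ℝ (g x) (σ x))) := by
    refine tendsto_integral_of_dominated_convergence (fun x => ‖g x‖) (fun n => ?_) hg.norm
      (fun n => ae_of_all _ fun x => ?_) ?_
    · exact hg.aestronglyMeasurable.inner (hψs n).continuous.aestronglyMeasurable
    · exact (norm_inner_le_norm _ _).trans (mul_le_of_le_one_right (norm_nonneg _) (hψ1 n x))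
    · filter_upwards [hlim] with x hx
      exact tendsto_const_nhds.inner hx
  have hval : ∫ x, inner ℝ (g x) (σ x) = ∫ x in K, ‖g x‖ := by
    rw [← integral_indicator hK.measurableSet]
    congr 1 with x
    by_cases hx : x ∈ K
    · rw [hσ, indicator_of_mem hx, indicator_of_mem hx, inner_smul_right,
        real_inner_self_eq_norm_sq]
      by_cases h0 : ‖g x‖ = 0
      · simp [h0]
      · field_simp
    · rw [hσ, indicator_of_notMem hx, indicator_of_notMem hx, inner_zero_right]
  rw [← hval]
  exact le_of_tendsto' hT hle

-- Monotone convergence along an exhaustion of `A` by compact sets.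
open MeasureTheory Filter Topology Set in
theorem setLIntegral_enorm_le_of_forall_smooth {N M : ℕ} {A : Set (Euc N)} (hA : IsOpen A)
    {g : Euc N → Euc M} (hg : Integrable g) {C : ℝ}
    (h : ∀ ψ : Euc N → Euc M, ContDiff ℝ ∞ ψ → HasCompactSupport ψ → tsupport ψ ⊆ A →
      (∀ x, ‖ψ x‖ ≤ 1) → ∫ x, inner ℝ (g x) (ψ x) ≤ C) :
    ∫⁻ x in A, ‖g x‖ₑ ≤ ENNReal.ofReal C := by
  obtain ⟨F, hFc, hFA, hFU, hFm⟩ := hA.exists_iUnion_isClosed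
  have hU : (⋃ n : ℕ, F n ∩ Metric.closedBall 0 n) = A := by
    refine Subset.antisymm (iUnion_subset fun n => inter_subset_left.trans (hFA n)) fun x hx => ?_
    rw [← hFU, mem_iUnion] at hx
    obtain ⟨n, hn⟩ := hx
    obtain ⟨m, hm⟩ := exists_nat_ge ‖x‖
    refine mem_iUnion.2 ⟨max n m, hFm (le_max_left _ _) hn, ?_⟩
    rw [mem_closedBall_zero_iff]
    exact hm.trans (Nat.cast_le.2 (le_max_right _ _))
  have hmono : Monotone fun n : ℕ => F n ∩ Metric.closedBall (0 : Euc N) n := fun m n hmn =>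
    inter_subset_inter (hFm hmn) (Metric.closedBall_subset_closedBall (Nat.cast_le.2 hmn))
  rw [← hU, setLIntegral_iUnion_of_directed _ hmono.directed_le]
  refine iSup_le fun n => ?_
  have hK : IsCompact (F n ∩ Metric.closedBall (0 : Euc N) n) :=
    (isCompact_closedBall _ _).inter_left (hFc n)
  rw [← ofReal_integral_norm_eq_lintegral_enorm hg.integrableOn]
  exact ENNReal.ofReal_le_ofReal
    (setIntegral_norm_le_of_forall_smooth hA hK (inter_subset_left.trans (hFA n)) hg h)

theorem divergence_smul_const {N : ℕ} {c : Euc N → ℝ} {x : Euc N} (hc : DifferentiableAt ℝ c x)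
    (h : Euc N) : divergence (fun y => c y • h) x = fderiv ℝ c x h := by
  have hf : fderiv ℝ (fun y => c y • h) x = (fderiv ℝ c x).smulRight h :=
    (hc.hasFDerivAt.smul_const h).fderiv
  have hsum : h = ∑ j, h j • EuclideanSpace.single j (1 : ℝ) := by
    ext i
    simp [Finset.sum_apply, Pi.single_apply]
  conv_rhs => rw [hsum, map_sum]
  simp only [divergence, hf, ContinuousLinearMap.smulRight_apply, PiLp.smul_apply, smul_eq_mul,
    map_smul]
  exact Finset.sum_congr rfl fun j _ => mul_comm _ _

open MeasureTheory in
theorem IsTestField.integral_le_totalVar {N M : ℕ} {A : Set (Euc N)} {φ : Fin M → Euc N → Euc N}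
    (hφ : IsTestField A φ) {u : Euc N → Euc M} (hu : totalVar A u ≠ ⊤) :
    ∫ x in A, ∑ i, u x i * divergence (φ i) x ≤ (totalVar A u).toReal :=
  (ENNReal.ofReal_le_iff_le_toReal hu).1 <| le_iSup₂
    (f := fun (φ : Fin M → Euc N → Euc N) (_ : IsTestField A φ) =>
      ENNReal.ofReal (∫ x in A, ∑ i, u x i * divergence (φ i) x)) φ hφ

open MeasureTheory Set in
/-- Testing `u` against the derivative of a smooth field in a fixed direction. -/
theorem integral_inner_fderiv_le {N M : ℕ} {Ω : Set (Euc N)} {u : Euc N → Euc M}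
    (hV : totalVar Ω u ≠ ⊤) {ψ : Euc N → Euc M} (hψ : ContDiff ℝ ∞ ψ) (hψc : HasCompactSupport ψ)
    (hψΩ : tsupport ψ ⊆ Ω) (hψ1 : ∀ x, ‖ψ x‖ ≤ 1) (h : Euc N) :
    ∫ x, inner ℝ (u x) (fderiv ℝ ψ x h) ≤ ‖h‖ * (totalVar Ω u).toReal := by
  rcases eq_or_ne h 0 with rfl | h0
  · simp
  have hn : 0 < ‖h‖ := norm_pos_iff.2 h0
  have hψi : ∀ i, ContDiff ℝ ∞ fun y => ψ y i := fun i => (contDiff_euclidean.1 hψ) i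
  -- The rank-one array `ψ ⊗ h/|h|` has the same Euclidean norm as `ψ`, and its divergence is the
  -- derivative of `ψ` along `h/|h|`.
  let φ : Fin M → Euc N → Euc N := fun i y => (ψ y i) • (‖h‖⁻¹ • h)
  have hts : ∀ i, tsupport (φ i) ⊆ tsupport ψ := fun i => by
    refine closure_mono fun x hx hx0 => hx ?_
    simp only [φ]
    rw [hx0]
    simp
  have hφ : IsTestField Ω φ :=
    { smooth := fun i => (hψi i).smul contDiff_const
      compact_support := fun i => hψc.of_isClosed_subset (isClosed_tsupport _) (hts i)
      support_subset := fun i => (hts i).trans hψΩ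
      norm_le_one := fun x => by
        have h1 : ∑ i, ‖φ i x‖ ^ 2 = ‖ψ x‖ ^ 2 := by
          rw [EuclideanSpace.norm_sq_eq]
          refine Finset.sum_congr rfl fun i _ => ?_
          simp only [φ, norm_smul, norm_inv, norm_norm, inv_mul_cancel₀ hn.ne', mul_one]
        rw [h1]
        exact pow_le_one₀ (norm_nonneg _) (hψ1 x) }
  have hdiff : Differentiable ℝ ψ := hψ.differentiable (by simp)
  have hcoord : ∀ x i, fderiv ℝ (fun y => ψ y i) x h = fderiv ℝ ψ x h i := fun x i => by
    have := (EuclideanSpace.proj (𝕜 := ℝ) i : Euc M →L[ℝ] ℝ).hasFDerivAt.comp x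
      (hdiff x).hasFDerivAt
    have h2 : HasFDerivAt (fun y => ψ y i) ((EuclideanSpace.proj i).comp (fderiv ℝ ψ x)) x := this
    rw [h2.fderiv]
    rfl
  have hdiv : ∀ x, ∑ i, u x i * divergence (φ i) x = ‖h‖⁻¹ * inner ℝ (u x) (fderiv ℝ ψ x h) :=
    fun x => by
      rw [PiLp.inner_apply, Finset.mul_sum]
      refine Finset.sum_congr rfl fun i _ => ?_
      rw [divergence_smul_const ((hψi i).differentiable (by simp) x), map_smul, hcoord]
      simp only [smul_eq_mul, RCLike.inner_apply, conj_trivial]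
      ring
  have hle := hφ.integral_le_totalVar hV
  simp_rw [hdiv] at hle
  rw [integral_const_mul, setIntegral_eq_integral_of_forall_compl_eq_zero] at hle
  · rwa [inv_mul_le_iff₀ hn] at hle
  · intro x hx
    have : fderiv ℝ ψ x = 0 :=
      Function.notMem_support.1 fun h' => hx (hψΩ (support_fderiv_subset ℝ h'))
    rw [this]
    simp

open MeasureTheory Set Filter Topology in
/-- The `L¹` size of the increments of a function along `h` is controlled by its total variation. -/
theorem setLIntegral_enorm_translate_sub_le {N M : ℕ} {Ω A : Set (Euc N)} (hA : IsOpen A)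
    {h : Euc N} (hAh : ∀ x ∈ A, ∀ t ∈ Icc (0 : ℝ) 1, x + t • h ∈ Ω) {u : Euc N → Euc M}
    (hu : Integrable u) :
    ∫⁻ x in A, ‖u (x + h) - u x‖ₑ ≤ ‖h‖ₑ * totalVar Ω u := by
  -- Treated apart because `0 * ⊤ = 0`; for `h ≠ 0` an infinite variation makes the right side `⊤`.
  rcases eq_or_ne h 0 with rfl | h0
  · simp
  by_cases hV : totalVar Ω u = ⊤
  · rw [hV, ENNReal.mul_top (by simpa using h0)]
    exact le_top
  have hC : ‖h‖ₑ * totalVar Ω u = ENNReal.ofReal (‖h‖ * (totalVar Ω u).toReal) := by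
    rw [ENNReal.ofReal_mul (norm_nonneg _), ENNReal.ofReal_toReal hV, ofReal_norm]
  rw [hC]
  refine setLIntegral_enorm_le_of_forall_smooth hA ((hu.comp_add_right h).sub hu)
    fun ψ hψ hψc hψA hψ1 => ?_
  have hdiff : Differentiable ℝ ψ := hψ.differentiable (by simp)
  obtain ⟨B, hB⟩ := hψc.exists_bound_of_continuous hψ.continuous
  obtain ⟨B', hB'⟩ := (hψc.fderiv (𝕜 := ℝ)).exists_bound_of_continuous
    (hψ.continuous_fderiv (by simp))
  have hcf : Continuous (fderiv ℝ ψ) := hψ.continuous_fderiv (by simp)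
  have hmeas : ∀ t : ℝ, AEStronglyMeasurable (fun y => inner ℝ (u y) (ψ (y - t • h))) volume :=
    fun t => hu.aestronglyMeasurable.inner
      (hψ.continuous.comp (continuous_id.sub continuous_const)).aestronglyMeasurable
  have hint : ∀ t : ℝ, Integrable fun y => inner ℝ (u y) (ψ (y - t • h)) := fun t =>
    (hu.norm.mul_const 1).mono' (hmeas t) <| ae_of_all _ fun y =>
      (norm_inner_le_norm _ _).trans (mul_le_mul_of_nonneg_left (hψ1 _) (norm_nonneg _))
  -- The shift is moved onto `ψ`, and `t ↦ ∫ u · ψ(y - t h)` is differentiated. For `0 ≤ t ≤ 1` the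
  -- shifted field is still supported in `Ω`, by `hAh`, so the derivative is at most `|h| |Du|(Ω)`
  -- and the mean value inequality concludes.
  have hder : ∀ t : ℝ, HasDerivAt (fun t : ℝ => ∫ y, inner ℝ (u y) (ψ (y - t • h)))
      (∫ y, inner ℝ (u y) (fderiv ℝ ψ (y - t • h) (-h))) t := fun t => by
    refine (hasDerivAt_integral_of_dominated_loc_of_deriv_le (s := univ)
      (F' := fun t y => inner ℝ (u y) (fderiv ℝ ψ (y - t • h) (-h)))
      (bound := fun y => ‖u y‖ * (B' * ‖h‖)) univ_mem (Eventually.of_forall hmeas) (hint t) ?_ ?_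
      (hu.norm.mul_const _) ?_).2
    · exact hu.aestronglyMeasurable.inner ((hcf.comp (continuous_id.sub
        continuous_const)).clm_apply continuous_const).aestronglyMeasurable
    · refine ae_of_all _ fun y s _ => (norm_inner_le_norm _ _).trans
        (mul_le_mul_of_nonneg_left ?_ (norm_nonneg _))
      refine (ContinuousLinearMap.le_opNorm _ _).trans ?_
      rw [norm_neg]
      exact mul_le_mul_of_nonneg_right (hB' _) (norm_nonneg _)
    · refine ae_of_all _ fun y s _ => ?_
      have h1 : HasDerivAt (fun s : ℝ => y - s • h) (-h) s := by
        simpa using ((hasDerivAt_id s).smul_const h).const_sub y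
      have h2 := (hdiff (y - s • h)).hasFDerivAt.comp_hasDerivAt s h1
      simpa using (hasDerivAt_const s (u y)).inner ℝ h2
  have hle : ∀ t ∈ interior (Icc (0 : ℝ) 1),
      deriv (fun t : ℝ => ∫ y, inner ℝ (u y) (ψ (y - t • h))) t
        ≤ ‖h‖ * (totalVar Ω u).toReal := fun t ht => by
    rw [(hder t).deriv]
    let ψt : Euc N → Euc M := fun y => ψ (y - t • h)
    have hfd : ∀ y, fderiv ℝ ψ (y - t • h) = fderiv ℝ ψt y := fun y =>
      (fderiv_comp_sub (𝕜 := ℝ) (f := ψ) (x := y) (t • h)).symm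
    have hcs : tsupport ψt ⊆ (fun y => y + t • h) '' tsupport ψ := by
      refine closure_minimal (fun y hy => ⟨y - t • h, subset_tsupport _ hy, by simp⟩) ?_
      exact (Homeomorph.addRight (t • h)).isClosedMap _ (isClosed_tsupport _)
    simp_rw [hfd]
    rw [← norm_neg h]
    refine integral_inner_fderiv_le hV (hψ.comp (contDiff_id.sub contDiff_const)) ?_ ?_
      (fun x => hψ1 _) (-h)
    · exact (hψc.isCompact.image (by fun_prop)).of_isClosed_subset (isClosed_tsupport _) hcs
    · refine hcs.trans ?_
      rintro _ ⟨y, hy, rfl⟩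
      exact hAh y (hψA hy) t (interior_subset ht)
  have hmv := (convex_Icc (0 : ℝ) 1).image_sub_le_mul_sub_of_deriv_le
    (fun t _ => (hder t).continuousAt.continuousWithinAt)
    (fun t _ => (hder t).differentiableAt.differentiableWithinAt) hle
    0 (by simp) 1 (by simp) zero_le_one
  have hshift : ∫ x, inner ℝ (u (x + h)) (ψ x) = ∫ y, inner ℝ (u y) (ψ (y - h)) := by
    rw [← integral_add_right_eq_self (fun y => inner ℝ (u y) (ψ (y - h))) h]
    simp
  have hi1 : Integrable fun x => inner ℝ (u (x + h)) (ψ x) := by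
    simpa using (hint 1).comp_add_right h
  have hi0 : Integrable fun x => inner ℝ (u x) (ψ x) := by simpa using hint 0
  simp only [Pi.sub_apply, inner_sub_left]
  rw [integral_sub hi1 hi0, hshift]
  simpa using hmv

/-! ### A Poincaré inequality by propagation of `L¹` control. -/

-- From `|u(x)| ≤ |u(x + h)| + |u(x + h) - u(x)|`: an `L¹` bound on `B` is carried back to `A`.
open MeasureTheory Set in
theorem setLIntegral_enorm_le_translate_add {N M : ℕ} {Ω A B : Set (Euc N)} (hA : IsOpen A)
    (hB : MeasurableSet B) {h : Euc N} (hAh : ∀ x ∈ A, ∀ t ∈ Icc (0 : ℝ) 1, x + t • h ∈ Ω)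
    (hAB : ∀ x ∈ A, x + h ∈ B) {u : Euc N → Euc M} (hu : Integrable u) :
    ∫⁻ x in A, ‖u x‖ₑ ≤ (∫⁻ x in B, ‖u x‖ₑ) + ‖h‖ₑ * totalVar Ω u := by
  calc ∫⁻ x in A, ‖u x‖ₑ ≤ ∫⁻ x in A, (‖u (x + h)‖ₑ + ‖u (x + h) - u x‖ₑ) := by
        refine lintegral_mono fun x => ?_
        simpa using enorm_sub_le (a := u (x + h)) (b := u (x + h) - u x)
    _ = (∫⁻ x in A, ‖u (x + h)‖ₑ) + ∫⁻ x in A, ‖u (x + h) - u x‖ₑ :=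
        lintegral_add_left' (hu.comp_add_right h).restrict.aestronglyMeasurable.enorm _
    _ ≤ _ := add_le_add ?_ (setLIntegral_enorm_translate_sub_le hA hAh hu)
  rw [← lintegral_indicator hB, ← lintegral_indicator hA.measurableSet,
    ← lintegral_add_right_eq_self (B.indicator _) h]
  refine lintegral_mono fun x => ?_
  by_cases hx : x ∈ A
  · rw [indicator_of_mem hx, indicator_of_mem (hAB x hx)]
  · rw [indicator_of_notMem hx]
    exact zero_le

-- Substitute `y = x + h` and swap the integrals. For fixed `h` the admissible `x` form an open set
-- whose segments to `x + h` stay in the ball by convexity, and which is empty for `|h| ≥ 2r`; the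
-- translation estimate is then integrated over `|h| < 2r`.
open MeasureTheory Set in
theorem setLIntegral_setLIntegral_enorm_sub_le {N M : ℕ} {Ω : Set (Euc N)} {x₀ : Euc N} {r : ℝ}
    (hB : Metric.ball x₀ r ⊆ Ω) {u : Euc N → Euc M} (hm : StronglyMeasurable u)
    (hu : Integrable u) :
    ∫⁻ x in Metric.ball x₀ r, ∫⁻ y in Metric.ball x₀ r, ‖u y - u x‖ₑ
      ≤ ENNReal.ofReal (2 * r) * totalVar Ω u * volume (Metric.ball (0 : Euc N) (2 * r)) := by
  set B := Metric.ball x₀ r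
  have hBm : MeasurableSet B := Metric.isOpen_ball.measurableSet
  let k : Euc N → Euc N → ENNReal := fun x y =>
    B.indicator (fun x => B.indicator (fun y => ‖u y - u x‖ₑ) y) x
  have hk : Measurable fun q : Euc N × Euc N => k q.1 (q.1 + q.2) := by
    have h1 : Measurable fun q : Euc N × Euc N => ‖u (q.1 + q.2) - u q.1‖ₑ :=
      ((hm.comp_measurable (measurable_fst.add measurable_snd)).sub
        (hm.comp_measurable measurable_fst)).enorm
    have h2 := (h1.indicator ((measurable_fst.add measurable_snd) hBm)).indicator
      (measurable_fst hBm)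
    exact h2
  have hkx : ∀ h x, k x (x + h) = (B ∩ (fun x => x + h) ⁻¹' B).indicator
      (fun x => ‖u (x + h) - u x‖ₑ) x := fun h x => by
    by_cases h1 : x ∈ B <;> by_cases h2 : x + h ∈ B <;> simp [k, h1, h2]
  calc ∫⁻ x in B, ∫⁻ y in B, ‖u y - u x‖ₑ = ∫⁻ x, ∫⁻ y, k x y := by
        rw [← lintegral_indicator hBm]
        refine lintegral_congr fun x => ?_
        by_cases hx : x ∈ B
        · simp only [k, indicator_of_mem hx]
          rw [lintegral_indicator hBm]
        · simp [k, hx]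
    _ = ∫⁻ x, ∫⁻ h, k x (x + h) :=
        lintegral_congr fun x => (lintegral_add_left_eq_self _ x).symm
    _ = ∫⁻ h, ∫⁻ x, k x (x + h) := lintegral_lintegral_swap hk.aemeasurable
    _ ≤ ∫⁻ h, (Metric.ball (0 : Euc N) (2 * r)).indicator
          (fun _ => ENNReal.ofReal (2 * r) * totalVar Ω u) h := by
        refine lintegral_mono fun h => ?_
        simp_rw [hkx]
        have hAo : IsOpen (B ∩ (fun x => x + h) ⁻¹' B) :=
          Metric.isOpen_ball.inter (Metric.isOpen_ball.preimage (by fun_prop))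
        rw [lintegral_indicator hAo.measurableSet]
        by_cases hh : h ∈ Metric.ball (0 : Euc N) (2 * r)
        · rw [indicator_of_mem hh]
          refine (setLIntegral_enorm_translate_sub_le (Ω := Ω) hAo (fun x hx t ht => hB ?_)
            hu).trans ?_
          · have := (convex_ball x₀ r).add_smul_sub_mem hx.1 hx.2 ht
            rwa [add_sub_cancel_left] at this
          · refine mul_le_mul_left ?_ _
            rw [← ofReal_norm]
            exact ENNReal.ofReal_le_ofReal (mem_ball_zero_iff.1 hh).le
        · have : B ∩ (fun x => x + h) ⁻¹' B = ∅ := by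
            refine eq_empty_of_forall_notMem fun x hx => hh ?_
            have h1 : ‖x - x₀‖ < r := mem_ball_iff_norm.1 hx.1
            have h2 : ‖x + h - x₀‖ < r := mem_ball_iff_norm.1 hx.2
            have h3 : ‖h‖ ≤ ‖x + h - x₀‖ + ‖x - x₀‖ := by
              simpa using norm_sub_le (x + h - x₀) (x - x₀)
            rw [mem_ball_zero_iff]
            linarith
          rw [this]
          simp
    _ = _ := by rw [lintegral_indicator_const Metric.isOpen_ball.measurableSet]

open MeasureTheory in
/-- Near `x`, the `L¹` norm is controlled by the `L¹` norm on `E` and the total variation. -/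
def IsControlledAt {N : ℕ} (M : ℕ) (Ω E : Set (Euc N)) (x : Euc N) : Prop :=
  ∃ r > 0, ∃ C : NNReal, ∀ u : Euc N → Euc M, StronglyMeasurable u → Integrable u →
    ∫⁻ y in Ω ∩ Metric.ball x r, ‖u y‖ₑ ≤ C * ((∫⁻ y in E, ‖u y‖ₑ) + totalVar Ω u)

-- A small enough ball about `x`, moved by `h`, lands in the ball controlled at `x + h`; the
-- constant grows by `|h|`.
open MeasureTheory Set in
theorem IsControlledAt.of_translate {N M : ℕ} {Ω E : Set (Euc N)} (hΩ : IsOpen Ω) {x h : Euc N}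
    (hx : IsControlledAt M Ω E (x + h)) {s : ℝ} (hs : 0 < s)
    (hseg : ∀ y ∈ Ω ∩ Metric.ball x s, ∀ t ∈ Icc (0 : ℝ) 1, y + t • h ∈ Ω) :
    IsControlledAt M Ω E x := by
  obtain ⟨r, hr, C, hC⟩ := hx
  refine ⟨min r s, lt_min hr hs, C + ‖h‖₊, fun u hm hu => ?_⟩
  refine (setLIntegral_enorm_le_translate_add (Ω := Ω) (B := Ω ∩ Metric.ball (x + h) r) (h := h)
    (hΩ.inter Metric.isOpen_ball) (hΩ.inter Metric.isOpen_ball).measurableSet ?_ ?_ hu).trans ?_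
  · exact fun y hy => hseg y ⟨hy.1, Metric.ball_subset_ball (min_le_right _ _) hy.2⟩
  · intro y hy
    refine ⟨?_, ?_⟩
    · simpa using hseg y ⟨hy.1, Metric.ball_subset_ball (min_le_right _ _) hy.2⟩ 1 (by simp)
    · rw [Metric.mem_ball, dist_add_right]
      exact (Metric.mem_ball.1 hy.2).trans_le (min_le_left _ _)
  · rw [ENNReal.coe_add, add_mul]
    refine add_le_add (hC u hm hu) ?_
    rw [← enorm_eq_nnnorm]
    gcongr
    exact le_add_self

-- Some point of `E` has only neighbourhoods meeting `E` in positive measure. On a ball `B` about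
-- it, integrate `|u(y)| ≤ |u(x)| + |u(y) - u(x)|` over `x ∈ E ∩ B`, `y ∈ B`, and divide by `|E ∩
-- B|`.
open MeasureTheory Set in
theorem exists_isControlledAt {N M : ℕ} {Ω E : Set (Euc N)} (hΩ : IsOpen Ω)
    (hEΩ : E ⊆ Ω) (hE0 : 0 < volume E) :
    ∃ x ∈ Ω, IsControlledAt M Ω E x := by
  obtain ⟨x, hxE, hx⟩ := exists_mem_forall_mem_nhdsWithin_pos_measure hE0.ne'
  obtain ⟨r, hr, hrΩ⟩ := Metric.isOpen_iff.1 hΩ x (hEΩ hxE)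
  refine ⟨x, hEΩ hxE, r, hr, ?_⟩
  set B := Metric.ball x r
  have hBm : MeasurableSet B := Metric.isOpen_ball.measurableSet
  have hpos : 0 < volume (E ∩ B) :=
    hx _ (inter_mem_nhdsWithin _ (Metric.ball_mem_nhds x hr))
  have hBt : volume B ≠ ⊤ := measure_ball_lt_top.ne
  have hfin : volume (E ∩ B) ≠ ⊤ := measure_ne_top_of_subset inter_subset_right hBt
  set c := ENNReal.ofReal (2 * r) * volume (Metric.ball (0 : Euc N) (2 * r)) with hc
  have hct : c ≠ ⊤ := ENNReal.mul_ne_top ENNReal.ofReal_ne_top measure_ball_lt_top.ne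
  have hCt : (volume B + c) / volume (E ∩ B) ≠ ⊤ :=
    ENNReal.div_ne_top (ENNReal.add_ne_top.2 ⟨hBt, hct⟩) hpos.ne'
  refine ⟨((volume B + c) / volume (E ∩ B)).toNNReal, fun u hm hu => ?_⟩
  rw [ENNReal.coe_toNNReal hCt, ← ENNReal.mul_div_right_comm,
    ENNReal.le_div_iff_mul_le (Or.inl hpos.ne') (Or.inl hfin)]
  have hum : Measurable fun y => ‖u y‖ₑ := hm.enorm
  calc (∫⁻ y in Ω ∩ B, ‖u y‖ₑ) * volume (E ∩ B)
      = ∫⁻ _ in E ∩ B, ∫⁻ y in B, ‖u y‖ₑ := by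
        rw [inter_eq_right.2 hrΩ, setLIntegral_const]
    _ ≤ ∫⁻ x in E ∩ B, (‖u x‖ₑ * volume B + ∫⁻ y in B, ‖u y - u x‖ₑ) := by
        refine lintegral_mono fun x => ?_
        rw [← setLIntegral_const, ← lintegral_add_left measurable_const]
        refine lintegral_mono fun y => ?_
        simpa using enorm_add_le (u x) (u y - u x)
    _ = (∫⁻ x in E ∩ B, ‖u x‖ₑ) * volume B + ∫⁻ x in E ∩ B, ∫⁻ y in B, ‖u y - u x‖ₑ := by
        rw [lintegral_add_left (hum.mul_const _), lintegral_mul_const _ hum]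
    _ ≤ (∫⁻ x in E, ‖u x‖ₑ) * volume B + c * totalVar Ω u := by
        refine add_le_add (mul_le_mul_left (lintegral_mono_set inter_subset_left) _) ?_
        refine (lintegral_mono_set inter_subset_right).trans
          ((setLIntegral_setLIntegral_enorm_sub_le hrΩ hm hu).trans_eq ?_)
        rw [hc]
        ring
    _ ≤ (volume B + c) * ((∫⁻ y in E, ‖u y‖ₑ) + totalVar Ω u) := by
        rw [add_mul, mul_add, mul_add, mul_comm (∫⁻ x in E, ‖u x‖ₑ)]
        exact add_le_add le_self_add le_add_self

-- Control passes between any two points of a small ball, so the controlled points form a nonempty,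
-- open and relatively closed subset of `Ω`.
open MeasureTheory Set in
theorem isControlledAt_of_isPreconnected {N M : ℕ} {Ω E : Set (Euc N)} (hΩ : IsOpen Ω)
    (hc : IsPreconnected Ω) (hEΩ : E ⊆ Ω) (hE0 : 0 < volume E)
    {x : Euc N} (hx : x ∈ Ω) : IsControlledAt M Ω E x := by
  have key : ∀ x ∈ Ω, ∃ s > 0, ∀ y ∈ Metric.ball x s,
      IsControlledAt M Ω E y → ∀ z ∈ Metric.ball x s, IsControlledAt M Ω E z := by
    intro x hx
    obtain ⟨r, hr, hrΩ⟩ := Metric.isOpen_iff.1 hΩ x hx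
    refine ⟨r / 2, by positivity, fun y hy hyc z hz => ?_⟩
    -- With this `s`, the moving point stays at distance less than `s + |z - x| + r/2 = r` from `x`.
    refine IsControlledAt.of_translate (h := y - z) hΩ (by simpa using hyc)
      (s := r / 2 - dist z x) (by rw [Metric.mem_ball] at hz; linarith)
      fun w hw t ht => hrΩ ?_
    have h1 : ‖y - x‖ < r / 2 := mem_ball_iff_norm.1 hy
    have h2 : ‖w - z‖ < r / 2 - ‖z - x‖ := by
      rw [← dist_eq_norm z x]; exact mem_ball_iff_norm.1 hw.2
    rw [mem_ball_iff_norm]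
    have h3 : w + t • (y - z) - x = (w - z) + ((1 - t) • (z - x) + t • (y - x)) := by module
    have h4 : ‖(1 - t) • (z - x)‖ ≤ ‖z - x‖ := by
      rw [norm_smul, Real.norm_of_nonneg (by linarith [ht.2])]
      exact mul_le_of_le_one_left (norm_nonneg _) (by linarith [ht.1])
    have h5 : ‖t • (y - x)‖ ≤ ‖y - x‖ := by
      rw [norm_smul, Real.norm_of_nonneg ht.1]
      exact mul_le_of_le_one_left (norm_nonneg _) ht.2
    rw [h3]
    linarith [norm_add_le (w - z) ((1 - t) • (z - x) + t • (y - x)),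
      norm_add_le ((1 - t) • (z - x)) (t • (y - x))]
  have hsub : Ω ⊆ {x | x ∈ Ω ∧ IsControlledAt M Ω E x} := by
    refine hc.subset_of_closure_inter_subset ?_ ?_ ?_
    · rw [Metric.isOpen_iff]
      rintro x ⟨hx, hxc⟩
      obtain ⟨s, hs, h⟩ := key x hx
      obtain ⟨r, hr, hrΩ⟩ := Metric.isOpen_iff.1 hΩ x hx
      exact ⟨min r s, lt_min hr hs, fun y hy =>
        ⟨hrΩ (Metric.ball_subset_ball (min_le_left _ _) hy),
          h x (Metric.mem_ball_self hs) hxc y (Metric.ball_subset_ball (min_le_right _ _) hy)⟩⟩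
    · obtain ⟨x, hx, hxc⟩ := exists_isControlledAt (M := M) hΩ hEΩ hE0
      exact ⟨x, hx, hx, hxc⟩
    · rintro x ⟨hxc, hx⟩
      obtain ⟨s, hs, h⟩ := key x hx
      obtain ⟨y, hy, hyx⟩ := Metric.mem_closure_iff.1 hxc s hs
      exact ⟨hx, h y (by rwa [Metric.mem_ball']) hy.2 x (Metric.mem_ball_self hs)⟩
  exact (hsub hx).2

-- At a boundary point, a shift by `(r/2) ν` moves up from the graph: the projection is unchanged
-- and the height grows, so points of `Ω` near `x` stay in `Ω`, and `x` itself is sent into `Ω`.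
open MeasureTheory Set Filter Topology in
theorem isControlledAt_of_mem_closure {N M : ℕ} {Ω E : Set (Euc N)} (hΩ : IsOpen Ω)
    (hc : IsPreconnected Ω) (hlip : HasLipschitzBoundary Ω) (hEΩ : E ⊆ Ω)
    (hE0 : 0 < volume E) {x : Euc N} (hx : x ∈ closure Ω) : IsControlledAt M Ω E x := by
  by_cases hxΩ : x ∈ Ω
  · exact isControlledAt_of_isPreconnected hΩ hc hEΩ hE0 hxΩ
  obtain ⟨ν, g, K, r, hν, hg, hr, hchart⟩ := hlip x (by
    rw [hΩ.frontier_eq]; exact ⟨hx, hxΩ⟩)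
  have hνν : inner ℝ ν ν = (1 : ℝ) := by rw [real_inner_self_eq_norm_sq, hν, one_pow]
  have hshift : ∀ (y : Euc N) (t : ℝ), y + t • ν ∈ Metric.ball x r →
      (y + t • ν ∈ Ω ↔ g (y - inner ℝ ν y • ν) < inner ℝ ν y + t) := fun y t hy => by
    rw [hchart _ hy, inner_add_right, inner_smul_right, hνν, mul_one]
    have : y + t • ν - (inner ℝ ν y + t) • ν = y - inner ℝ ν y • ν := by module
    rw [this]
  -- The strict inequality valid in `Ω` becomes weak in the limit at `x`; the upward shift makes it
  -- strict again.
  have hgx : g (x - inner ℝ ν x • ν) ≤ inner ℝ ν x := by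
    have hcont : ContinuousWithinAt (fun y => g (y - inner ℝ ν y • ν)) Ω x :=
      (hg.continuous.comp (by fun_prop)).continuousWithinAt
    have hcont' : ContinuousWithinAt (fun y : Euc N => inner ℝ ν y) Ω x :=
      Continuous.continuousWithinAt (by fun_prop)
    have : (𝓝[Ω] x).NeBot := mem_closure_iff_nhdsWithin_neBot.1 hx
    refine le_of_tendsto_of_tendsto hcont hcont' ?_
    filter_upwards [self_mem_nhdsWithin,
      mem_nhdsWithin_of_mem_nhds (Metric.ball_mem_nhds x hr)] with y hy hyr
    exact ((hchart y hyr).1 hy).le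
  have hball : ∀ y ∈ Metric.ball x (r / 2), ∀ t ∈ Icc (0 : ℝ) 1,
      y + (t * (r / 2)) • ν ∈ Metric.ball x r := fun y hy t ht => by
    rw [mem_ball_iff_norm] at hy ⊢
    have h1 : ‖(t * (r / 2)) • ν‖ ≤ r / 2 := by
      rw [norm_smul, hν, mul_one, Real.norm_of_nonneg (mul_nonneg ht.1 (by positivity))]
      exact mul_le_of_le_one_left (by positivity) ht.2
    have h2 : y + (t * (r / 2)) • ν - x = (y - x) + (t * (r / 2)) • ν := by abel
    rw [h2]
    linarith [norm_add_le (y - x) ((t * (r / 2)) • ν)]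
  have hxm : x + (r / 2) • ν ∈ Ω := by
    have := hball x (Metric.mem_ball_self (by positivity)) 1 (by simp)
    rw [one_mul] at this
    rw [hshift x _ this]
    linarith
  refine (isControlledAt_of_isPreconnected (M := M) hΩ hc hEΩ hE0 hxm).of_translate hΩ
    (s := r / 2) (by positivity) fun y hy t ht => ?_
  rw [smul_smul, hshift y _ (hball y hy.2 t ht)]
  have h0 := (hchart y (Metric.ball_subset_ball (by linarith) hy.2)).1 hy.1
  have : 0 ≤ t * (r / 2) := mul_nonneg ht.1 (by positivity)
  linarith

open MeasureTheory Set Filter Topology in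
/-- A Poincaré inequality: the `L¹` norm is controlled by the `L¹` norm on a non-null subset
together with the total variation. -/
theorem exists_setLIntegral_enorm_le {N : ℕ} (M : ℕ) {Ω E : Set (Euc N)} (hΩ : IsOpen Ω)
    (hb : Bornology.IsBounded Ω)
    (hc : IsPreconnected Ω) (hlip : HasLipschitzBoundary Ω) (hEΩ : E ⊆ Ω)
    (hE0 : 0 < volume E) : ∃ C : NNReal, ∀ u : Euc N → Euc M, StronglyMeasurable u →
      Integrable u → ∫⁻ y in Ω, ‖u y‖ₑ ≤ C * ((∫⁻ y in E, ‖u y‖ₑ) + totalVar Ω u) := by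
  have hcl : IsCompact (closure Ω) := hb.isCompact_closure
  suffices h : ∃ C : NNReal, ∀ u : Euc N → Euc M, StronglyMeasurable u → Integrable u →
      ∫⁻ y in Ω ∩ closure Ω, ‖u y‖ₑ ≤ C * ((∫⁻ y in E, ‖u y‖ₑ) + totalVar Ω u) by
    rwa [inter_eq_left.2 subset_closure] at h
  refine hcl.induction_on (p := fun S => ∃ C : NNReal, ∀ u : Euc N → Euc M,
    StronglyMeasurable u → Integrable u →
      ∫⁻ y in Ω ∩ S, ‖u y‖ₑ ≤ C * ((∫⁻ y in E, ‖u y‖ₑ) + totalVar Ω u)) ?_ ?_ ?_ ?_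
  · exact ⟨0, fun u _ _ => by simp⟩
  · rintro S T hST ⟨C, hC⟩
    exact ⟨C, fun u hm hu =>
      (lintegral_mono_set (inter_subset_inter_right _ hST)).trans (hC u hm hu)⟩
  · rintro S T ⟨C, hC⟩ ⟨C', hC'⟩
    refine ⟨C + C', fun u hm hu => ?_⟩
    rw [inter_union_distrib_left, ENNReal.coe_add, add_mul]
    exact (lintegral_union_le _ _ _).trans (add_le_add (hC u hm hu) (hC' u hm hu))
  · intro x hx
    obtain ⟨r, hr, C, hC⟩ := isControlledAt_of_mem_closure (M := M) hΩ hc hlip hEΩ hE0 hx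
    exact ⟨Metric.ball x r, mem_nhdsWithin_of_mem_nhds (Metric.ball_mem_nhds x hr), C, hC⟩

/-! ### Averages on a grid of cubes and a Kolmogorov criterion. -/

/-- The index of the half-open cube of side `s` in the standard grid containing `x`. -/
noncomputable def cubeIndex {N : ℕ} (s : ℝ) (x : Euc N) : Fin N → ℤ := fun i => ⌊x i / s⌋

theorem preimage_cubeIndex {N : ℕ} {s : ℝ} (hs : 0 < s) (k : Fin N → ℤ) :
    cubeIndex s ⁻¹' {k} = (WithLp.ofLp : Euc N → Fin N → ℝ) ⁻¹'
      Set.pi Set.univ fun i => Set.Ico (k i * s) ((k i + 1) * s) := by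
  ext x
  simp only [Set.mem_preimage, Set.mem_singleton_iff, Set.mem_pi, Set.mem_univ, forall_true_left,
    Set.mem_Ico, funext_iff, cubeIndex, Int.floor_eq_iff, le_div_iff₀ hs, div_lt_iff₀ hs]

theorem measurableSet_preimage_cubeIndex {N : ℕ} {s : ℝ} (hs : 0 < s) (k : Fin N → ℤ) :
    MeasurableSet (cubeIndex s ⁻¹' {k} : Set (Euc N)) := by
  rw [preimage_cubeIndex hs]
  exact (PiLp.volume_preserving_ofLp (Fin N)).measurable
    (MeasurableSet.univ_pi fun _ => measurableSet_Ico)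

open MeasureTheory in
theorem volume_preimage_cubeIndex {N : ℕ} {s : ℝ} (hs : 0 < s) (k : Fin N → ℤ) :
    volume (cubeIndex s ⁻¹' {k} : Set (Euc N)) = ENNReal.ofReal (s ^ N) := by
  rw [preimage_cubeIndex hs, (PiLp.volume_preserving_ofLp (Fin N)).measure_preimage
    (MeasurableSet.univ_pi fun _ => measurableSet_Ico).nullMeasurableSet, Real.volume_pi_Ico]
  have : ∀ i, ((k i : ℝ) + 1) * s - k i * s = s := fun i => by ring
  simp [this, ENNReal.ofReal_pow hs.le]

open MeasureTheory in
theorem volume_cube {N : ℕ} {s : ℝ} (hs : 0 < s) :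
    volume ((WithLp.ofLp : Euc N → Fin N → ℝ) ⁻¹' Set.pi Set.univ fun _ => Set.Icc (-s) s)
      = ENNReal.ofReal (2 ^ N * s ^ N) := by
  rw [(PiLp.volume_preserving_ofLp (Fin N)).measure_preimage
    (MeasurableSet.univ_pi fun _ => measurableSet_Icc).nullMeasurableSet, volume_pi_pi,
    ← mul_pow]
  have : s - -s = 2 * s := by ring
  simp [Real.volume_Icc, this, ENNReal.ofReal_pow (mul_pos two_pos hs).le]

theorem norm_le_of_abs_le {N : ℕ} {s : ℝ} {h : Euc N} (hh : ∀ i, |h i| ≤ s) : ‖h‖ ≤ N * s := by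
  have hsum : h = ∑ j, h j • EuclideanSpace.single j (1 : ℝ) := by
    ext i
    simp [Finset.sum_apply, Pi.single_apply]
  rw [hsum]
  refine (norm_sum_le_of_le (f := fun j => h j • EuclideanSpace.single j (1 : ℝ)) Finset.univ
    (n := fun _ => s) fun j _ => ?_).trans_eq (by simp)
  rw [norm_smul]
  simpa using hh j

open MeasureTheory Set in
theorem enorm_sub_setAverage_cube_le {N M : ℕ} {s : ℝ} (hs : 0 < s) {v : Euc N → Euc M}
    (hv : Integrable v) (x : Euc N) :
    ENNReal.ofReal (s ^ N) * ‖v x - ⨍ y in cubeIndex s ⁻¹' {cubeIndex s x}, v y‖ₑ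
      ≤ ∫⁻ y in cubeIndex s ⁻¹' {cubeIndex s x}, ‖v y - v x‖ₑ := by
  set Q : Set (Euc N) := cubeIndex s ⁻¹' {cubeIndex s x}
  have hQ : volume Q = ENNReal.ofReal (s ^ N) := volume_preimage_cubeIndex hs _
  have hQt : volume Q ≠ ⊤ := by rw [hQ]; exact ENNReal.ofReal_ne_top
  have hQr : volume.real Q = s ^ N := by
    rw [measureReal_def, hQ, ENNReal.toReal_ofReal (by positivity)]
  have h1 : ∫ y in Q, (v x - v y) = s ^ N • (v x - ⨍ y in Q, v y) := by
    rw [integral_sub (f := fun _ => v x) (integrableOn_const hQt (by simp)) hv.integrableOn, setIntegral_const, hQr,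
      setAverage_eq, hQr, smul_sub, smul_smul, mul_inv_cancel₀ (by positivity), one_smul]
  calc ENNReal.ofReal (s ^ N) * ‖v x - ⨍ y in Q, v y‖ₑ = ‖∫ y in Q, (v x - v y)‖ₑ := by
        rw [h1, enorm_smul, Real.enorm_of_nonneg (by positivity)]
    _ ≤ ∫⁻ y in Q, ‖v x - v y‖ₑ := enorm_integral_le_lintegral_enorm _
    _ = _ := lintegral_congr fun y => enorm_sub_rev _ _

-- Two points of one cube differ by some `h ∈ [-s, s]ᴺ`, so the error is at most `s⁻ᴺ` times the
-- integral over such `h` of the `L¹` increments. That box has volume `2ᴺ sᴺ`, and `|h| ≤ N s` on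
-- it.
open MeasureTheory Set in
theorem lintegral_enorm_sub_setAverage_cube_le {N M : ℕ} {s : ℝ} (hs : 0 < s)
    {v : Euc N → Euc M} (hm : StronglyMeasurable v) (hv : Integrable v) {C : ENNReal}
    (hC : ∀ h, ∫⁻ x, ‖v (x + h) - v x‖ₑ ≤ C * ‖h‖ₑ) :
    ∫⁻ x, ‖v x - ⨍ y in cubeIndex s ⁻¹' {cubeIndex s x}, v y‖ₑ
      ≤ C * ENNReal.ofReal (2 ^ N * (N * s)) := by
  set H : Set (Euc N) :=
    (WithLp.ofLp : Euc N → Fin N → ℝ) ⁻¹' Set.pi Set.univ fun _ => Set.Icc (-s) s with hHdef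
  have hH : MeasurableSet H := (PiLp.volume_preserving_ofLp (Fin N)).measurable
    (MeasurableSet.univ_pi fun _ => measurableSet_Icc)
  have hq0 : ENNReal.ofReal (s ^ N) ≠ 0 := by simpa using pow_pos hs N
  have hmeas : Measurable fun q : Euc N × Euc N => ‖v (q.1 + q.2) - v q.1‖ₑ :=
    ((hm.comp_measurable (measurable_fst.add measurable_snd)).sub
      (hm.comp_measurable measurable_fst)).enorm
  have hdiff : ∀ x : Euc N, ∫⁻ y in cubeIndex s ⁻¹' {cubeIndex s x}, ‖v y - v x‖ₑ
      ≤ ∫⁻ h in H, ‖v (x + h) - v x‖ₑ := fun x => by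
    rw [← lintegral_indicator hH, ← lintegral_indicator (measurableSet_preimage_cubeIndex hs _),
      ← lintegral_add_left_eq_self _ x]
    refine lintegral_mono fun h => ?_
    by_cases hx : x + h ∈ cubeIndex s ⁻¹' {cubeIndex s x}
    · have hhH : h ∈ H := by
        have h0 : x ∈ cubeIndex s ⁻¹' {cubeIndex s x} := rfl
        rw [preimage_cubeIndex hs] at hx h0
        intro i _
        have h1 := hx i trivial
        have h2 := h0 i trivial
        simp only [PiLp.add_apply, mem_Ico] at h1 h2
        constructor <;> linarith [h1.1, h1.2, h2.1, h2.2]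
      rw [indicator_of_mem hx, indicator_of_mem hhH]
    · rw [indicator_of_notMem hx]
      exact zero_le
  rw [← ENNReal.mul_le_mul_iff_right hq0 ENNReal.ofReal_ne_top,
    ← lintegral_const_mul' _ _ ENNReal.ofReal_ne_top]
  calc ∫⁻ x, ENNReal.ofReal (s ^ N) * ‖v x - ⨍ y in cubeIndex s ⁻¹' {cubeIndex s x}, v y‖ₑ
      ≤ ∫⁻ x, ∫⁻ h in H, ‖v (x + h) - v x‖ₑ :=
        lintegral_mono fun x => (enorm_sub_setAverage_cube_le hs hv x).trans (hdiff x)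
    _ = ∫⁻ h in H, ∫⁻ x, ‖v (x + h) - v x‖ₑ := lintegral_lintegral_swap hmeas.aemeasurable
    _ ≤ ∫⁻ _ in H, C * ENNReal.ofReal (N * s) := by
        refine setLIntegral_mono measurable_const fun h hh => (hC h).trans ?_
        refine mul_le_mul_right ?_ _
        rw [← ofReal_norm]
        exact ENNReal.ofReal_le_ofReal (norm_le_of_abs_le fun i => abs_le.2 (hh i trivial))
    _ = ENNReal.ofReal (s ^ N) * (C * ENNReal.ofReal (2 ^ N * (N * s))) := by
        rw [setLIntegral_const, hHdef, volume_cube hs, mul_assoc, mul_left_comm (ENNReal.ofReal (s ^ N)),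
          ← ENNReal.ofReal_mul (by positivity), ← ENNReal.ofReal_mul (by positivity)]
        congr 2
        ring

open Set in
theorem finite_image_cubeIndex {N : ℕ} {s R : ℝ} (hs : 0 < s) :
    (cubeIndex s '' Metric.closedBall (0 : Euc N) R).Finite := by
  refine (finite_Icc (fun _ : Fin N => ⌊-R / s⌋) fun _ => ⌊R / s⌋).subset ?_
  rintro _ ⟨x, hx, rfl⟩
  have h : ∀ i, |x i| ≤ R := fun i => by
    have h1 := PiLp.norm_apply_le x i
    rw [mem_closedBall_zero_iff] at hx
    exact h1.trans hx
  exact ⟨fun i => Int.floor_le_floor (div_le_div_of_nonneg_right (abs_le.1 (h i)).1 hs.le),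
    fun i => Int.floor_le_floor (div_le_div_of_nonneg_right (abs_le.1 (h i)).2 hs.le)⟩

open MeasureTheory Set in
theorem norm_setAverage_cube_le {N M : ℕ} {s : ℝ} (hs : 0 < s) {v : Euc N → Euc M}
    (hv : Integrable v) (k : Fin N → ℤ) :
    ‖⨍ y in cubeIndex s ⁻¹' {k}, v y‖ ≤ (s ^ N)⁻¹ * ∫ x, ‖v x‖ := by
  rw [setAverage_eq, measureReal_def, volume_preimage_cubeIndex hs,
    ENNReal.toReal_ofReal (by positivity), norm_smul, Real.norm_of_nonneg (by positivity)]
  refine mul_le_mul_of_nonneg_left ?_ (by positivity)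
  exact (norm_integral_le_integral_norm _).trans
    (setIntegral_le_integral hv.norm (ae_of_all _ fun _ => norm_nonneg _))

open MeasureTheory Set in
/-- A Kolmogorov compactness criterion: a bounded family in `L¹` of functions with supports in a
fixed ball and a common linear modulus of continuity under translations is totally bounded. -/
theorem totallyBounded_Lp_one_of_translate {N M : ℕ} {R : ℝ} {B : ℝ} {C : NNReal}
    {S : Set (Lp (Euc M) 1 (volume : Measure (Euc N)))}
    (hR : ∀ v ∈ S, ∀ᵐ x, x ∉ Metric.closedBall (0 : Euc N) R → v x = 0)
    (hB : ∀ v ∈ S, ‖v‖ ≤ B)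
    (hC : ∀ v ∈ S, ∀ h, ∫⁻ x, ‖v (x + h) - v x‖ₑ ≤ C * ‖h‖ₑ) : TotallyBounded S := by
  refine Metric.totallyBounded_of_finite_discretization fun ε hε => ?_
  set K := Metric.closedBall (0 : Euc N) R
  have hKt : volume K ≠ ⊤ := measure_closedBall_lt_top.ne
  -- The cube size `s` makes each of the two averaging errors less than `ε / 3`; `η` below does the
  -- same for the rounding of averages. The `+ 1` keeps the denominators positive.
  obtain ⟨s, hs, hsε⟩ : ∃ s : ℝ, 0 < s ∧ C * (2 ^ N * (N * s)) < ε / 3 := by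
    refine ⟨ε / 3 / (C * (2 ^ N * N) + 1), by positivity, ?_⟩
    have h1 : (0 : ℝ) < C * (2 ^ N * N) + 1 := by positivity
    have h2 : C * (2 ^ N * (N * (ε / 3 / (C * (2 ^ N * N) + 1))))
        = (C * (2 ^ N * N)) * (ε / 3) / (C * (2 ^ N * N) + 1) := by ring
    rw [h2, div_lt_iff₀ h1, mul_comm]
    have : (0 : ℝ) < ε / 3 := by positivity
    exact mul_lt_mul_of_pos_left (by linarith) this
  obtain ⟨η, hη, hηε⟩ : ∃ η : ℝ, 0 < η ∧ 2 * η * volume.real K < ε / 3 := by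
    refine ⟨ε / 3 / (2 * volume.real K + 1), by positivity, ?_⟩
    have h1 : (0 : ℝ) < 2 * volume.real K + 1 := by positivity
    have h2 : 2 * (ε / 3 / (2 * volume.real K + 1)) * volume.real K
        = (2 * volume.real K) * (ε / 3) / (2 * volume.real K + 1) := by ring
    rw [h2, div_lt_iff₀ h1, mul_comm]
    have : (0 : ℝ) < ε / 3 := by positivity
    exact mul_lt_mul_of_pos_left (by linarith) this
  obtain ⟨t, ht, htc⟩ := Metric.totallyBounded_iff.1
    (isCompact_closedBall (0 : Euc M) ((s ^ N)⁻¹ * B)).totallyBounded η hη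
  let avg : Lp (Euc M) 1 (volume : Measure (Euc N)) → (Fin N → ℤ) → Euc M :=
    fun v k => ⨍ y in cubeIndex s ⁻¹' {k}, v y
  have hvi : ∀ v : Lp (Euc M) 1 (volume : Measure (Euc N)), Integrable v :=
    fun v => L1.integrable_coeFn v
  have havg : ∀ v ∈ S, ∀ k, ∃ y ∈ t, avg v k ∈ Metric.ball y η := fun v hv k => by
    have h1 : avg v k ∈ Metric.closedBall (0 : Euc M) ((s ^ N)⁻¹ * B) := by
      rw [mem_closedBall_zero_iff]
      refine (norm_setAverage_cube_le hs (hvi v) k).trans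
        (mul_le_mul_of_nonneg_left ?_ (by positivity))
      rw [← L1.norm_eq_integral_norm]
      exact hB v hv
    simpa using htc h1
  choose! F hFt hF using havg
  have hJ := finite_image_cubeIndex (N := N) (R := R) hs
  have := hJ.fintype
  have := ht.fintype
  -- The discrete datum of `v`: for each of the finitely many cubes meeting `K`, a point of the
  -- finite `η`-net near the average of `v`.
  refine ⟨(cubeIndex s '' K) → t, inferInstance, fun v k => ⟨F v k, hFt v v.2 k⟩, ?_⟩
  rintro ⟨v, hv⟩ ⟨w, hw⟩ hvw
  have hclose : ∀ x ∈ K, ‖avg v (cubeIndex s x) - avg w (cubeIndex s x)‖ₑ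
      ≤ ENNReal.ofReal (2 * η) := fun x hx => by
    have h1 := congrArg Subtype.val (congrFun hvw ⟨cubeIndex s x, x, hx, rfl⟩)
    simp only at h1
    have h2 := Metric.mem_ball.1 (hF v hv (cubeIndex s x))
    have h3 := Metric.mem_ball.1 (hF w hw (cubeIndex s x))
    rw [h1] at h2
    rw [← ofReal_norm, ← dist_eq_norm]
    refine ENNReal.ofReal_le_ofReal ?_
    linarith [dist_triangle_right (avg v (cubeIndex s x)) (avg w (cubeIndex s x))
      (F w (cubeIndex s x))]
  have hκm : Measurable (cubeIndex s : Euc N → Fin N → ℤ) := measurable_to_countable'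
    (measurableSet_preimage_cubeIndex hs)
  have herr : ∀ v ∈ S, ∫⁻ x, ‖v x - avg v (cubeIndex s x)‖ₑ ≤ ENNReal.ofReal (ε / 3) :=
    fun v hv => by
      refine (lintegral_enorm_sub_setAverage_cube_le hs (Lp.stronglyMeasurable v) (hvi v)
        (hC v hv)).trans ?_
      rw [← ENNReal.ofReal_coe_nnreal, ← ENNReal.ofReal_mul C.coe_nonneg]
      exact ENNReal.ofReal_le_ofReal hsε.le
  have hmeas : ∀ v, Measurable fun x => ‖v x - avg v (cubeIndex s x)‖ₑ := fun v =>
    ((Lp.stronglyMeasurable v).measurable.sub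
      ((measurable_of_countable (avg v)).comp hκm)).enorm
  have hmain : edist v w ≤ ENNReal.ofReal (ε / 3) +
      (ENNReal.ofReal (2 * η * volume.real K) + ENNReal.ofReal (ε / 3)) := by
    rw [L1.edist_def]
    calc ∫⁻ x, edist (v x) (w x)
        ≤ ∫⁻ x, (‖v x - avg v (cubeIndex s x)‖ₑ +
            (K.indicator (fun _ => ENNReal.ofReal (2 * η)) x
              + ‖w x - avg w (cubeIndex s x)‖ₑ)) := by
          refine lintegral_mono_ae ?_
          filter_upwards [hR v hv, hR w hw] with x hxv hxw
          by_cases hx : x ∈ K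
          · rw [indicator_of_mem hx]
            refine le_trans ?_ (add_le_add_right (add_le_add_left (hclose x hx) _) _)
            simp only [← edist_eq_enorm_sub]
            refine (edist_triangle _ (avg v (cubeIndex s x)) _).trans
              (add_le_add_right ?_ _)
            rw [edist_comm (w x)]
            exact edist_triangle _ _ _
          · rw [hxv hx, hxw hx, edist_self]
            exact zero_le
      _ = (∫⁻ x, ‖v x - avg v (cubeIndex s x)‖ₑ) + (ENNReal.ofReal (2 * η) * volume K
            + ∫⁻ x, ‖w x - avg w (cubeIndex s x)‖ₑ) := by
          rw [lintegral_add_left (hmeas v), lintegral_add_right _ (hmeas w),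
            lintegral_indicator_const Metric.isClosed_closedBall.measurableSet]
      _ ≤ _ := by
          refine add_le_add (herr v hv) (add_le_add (le_of_eq ?_) (herr w hw))
          rw [ENNReal.ofReal_mul (mul_pos two_pos hη).le, measureReal_def,
            ENNReal.ofReal_toReal hKt]
  rw [← ENNReal.ofReal_add (by positivity) (by positivity),
    ← ENNReal.ofReal_add (by positivity) (by positivity), edist_dist,
    ENNReal.ofReal_le_ofReal_iff (by positivity)] at hmain
  simp only
  linarith

/-! ### Compactness in `BV` through the distance weight. -/

open MeasureTheory Set in
/-- Weighting by the distance to the complement turns functions of bounded variation on `Ω` into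
functions with a linear `L¹` modulus of continuity on the whole space. -/
theorem lintegral_enorm_infDist_smul_translate_sub_le {N M : ℕ} {Ω : Set (Euc N)} {W : NNReal}
    (hW : ∀ x, Metric.infDist x Ωᶜ ≤ W) {u : Euc N → Euc M} (hm : StronglyMeasurable u)
    (hu : Integrable u) (h : Euc N) :
    ∫⁻ x, ‖Metric.infDist (x + h) Ωᶜ • u (x + h) - Metric.infDist x Ωᶜ • u x‖ₑ
      ≤ (W * totalVar Ω u + 3 * ∫⁻ x, ‖u x‖ₑ) * ‖h‖ₑ := by
  set d : Euc N → ℝ := fun x => Metric.infDist x Ωᶜ with hd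
  have hd0 : ∀ x, 0 ≤ d x := fun x => Metric.infDist_nonneg
  have hdW : ∀ x, ‖d x‖ₑ ≤ W := fun x => by
    rw [Real.enorm_of_nonneg (hd0 x), ← ENNReal.ofReal_coe_nnreal]
    exact ENNReal.ofReal_le_ofReal (hW x)
  have hlip : ∀ x, |d (x + h) - d x| ≤ ‖h‖ := fun x => by
    have := (Metric.lipschitz_infDist_pt Ωᶜ).dist_le_mul (x + h) x
    simpa [Real.dist_eq, hd] using this
  -- On `A` the segment from `x` to `x + h` stays in `Ω`, so the translation estimate applies. Off
  -- `A` both weights are small, `d x ≤ |h|` and `d (x + h) ≤ 2|h|`, whence the constant `3 = 2 +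
  -- 1`.
  set A : Set (Euc N) := {x | ‖h‖ < d x} with hA
  have hAo : IsOpen A := isOpen_lt continuous_const (Metric.continuous_infDist_pt _)
  have hAΩ : ∀ x ∈ A, ∀ t ∈ Icc (0 : ℝ) 1, x + t • h ∈ Ω := fun x hx t ht => by
    by_contra hc
    have h1 : d x ≤ dist x (x + t • h) := Metric.infDist_le_dist_of_mem hc
    rw [dist_self_add_right, norm_smul, Real.norm_of_nonneg ht.1] at h1
    have h2 : t * ‖h‖ ≤ ‖h‖ := mul_le_of_le_one_left (norm_nonneg _) ht.2
    exact absurd hx (not_lt.2 (h1.trans h2))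
  have hpt : ∀ x, ‖d (x + h) • u (x + h) - d x • u x‖ₑ
      ≤ W * A.indicator (fun x => ‖u (x + h) - u x‖ₑ) x
        + (2 * ‖h‖ₑ * ‖u (x + h)‖ₑ + ‖h‖ₑ * ‖u x‖ₑ) := fun x => by
    have hl : ‖d (x + h) - d x‖ₑ ≤ ‖h‖ₑ := enorm_le_iff_norm_le.2 (hlip x)
    by_cases hx : x ∈ A
    · rw [indicator_of_mem hx]
      have h1 : d (x + h) • u (x + h) - d x • u x
          = d x • (u (x + h) - u x) + (d (x + h) - d x) • u (x + h) := by module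
      rw [h1]
      refine (enorm_add_le _ _).trans (add_le_add ?_ ?_)
      · rw [enorm_smul]
        exact mul_le_mul_left (hdW x) _
      · rw [enorm_smul]
        refine (mul_le_mul_left (hl.trans ?_) _).trans le_self_add
        exact le_mul_of_one_le_left zero_le one_le_two
    · have hx' : ‖d x‖ₑ ≤ ‖h‖ₑ := enorm_le_iff_norm_le.2 (by
        rw [Real.norm_of_nonneg (hd0 x)]; exact not_lt.1 hx)
      have hxh : ‖d (x + h)‖ₑ ≤ 2 * ‖h‖ₑ := by
        calc ‖d (x + h)‖ₑ = ‖(d (x + h) - d x) + d x‖ₑ := by rw [sub_add_cancel]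
          _ ≤ ‖h‖ₑ + ‖h‖ₑ := (enorm_add_le _ _).trans (add_le_add hl hx')
          _ = _ := (two_mul _).symm
      refine (enorm_sub_le).trans (le_trans ?_ le_add_self)
      rw [enorm_smul, enorm_smul]
      exact add_le_add (mul_le_mul_left hxh _) (mul_le_mul_left hx' _)
  have hum : Measurable fun x => ‖u x‖ₑ := hm.enorm
  have hum' : Measurable fun x => ‖u (x + h)‖ₑ := hum.comp (measurable_add_const h)
  have hdm : Measurable (A.indicator fun x => ‖u (x + h) - u x‖ₑ) :=
    Measurable.indicator ((hm.comp_measurable (measurable_add_const h)).sub hm).enorm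
      hAo.measurableSet
  calc ∫⁻ x, ‖d (x + h) • u (x + h) - d x • u x‖ₑ
      ≤ ∫⁻ x, (W * A.indicator (fun x => ‖u (x + h) - u x‖ₑ) x
        + (2 * ‖h‖ₑ * ‖u (x + h)‖ₑ + ‖h‖ₑ * ‖u x‖ₑ)) := lintegral_mono hpt
    _ = W * (∫⁻ x in A, ‖u (x + h) - u x‖ₑ)
        + (2 * ‖h‖ₑ * (∫⁻ x, ‖u x‖ₑ) + ‖h‖ₑ * ∫⁻ x, ‖u x‖ₑ) := by
      rw [lintegral_add_left (hdm.const_mul _), lintegral_add_left (hum'.const_mul _),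
        lintegral_const_mul _ hdm, lintegral_const_mul _ hum', lintegral_const_mul _ hum,
        lintegral_indicator hAo.measurableSet, lintegral_add_right_eq_self (fun x => ‖u x‖ₑ) h]
    _ ≤ W * (‖h‖ₑ * totalVar Ω u) + (2 * ‖h‖ₑ * (∫⁻ x, ‖u x‖ₑ) + ‖h‖ₑ * ∫⁻ x, ‖u x‖ₑ) := by
      gcongr
      exact setLIntegral_enorm_translate_sub_le hAo hAΩ hu
    _ = _ := by ring

open MeasureTheory Set Filter Topology in
/-- Compactness of sequences bounded in `BV(Ω)`. -/
theorem exists_subseq_tendsto_of_totalVar_le {N M : ℕ} {Ω : Set (Euc N)} (hΩ : IsOpen Ω)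
    (hb : Bornology.IsBounded Ω) (hne : Ωᶜ.Nonempty) {u : ℕ → Euc N → Euc M}
    (hm : ∀ n, StronglyMeasurable (u n)) {B : NNReal} (hu : ∀ n, ∫⁻ x, ‖u n x‖ₑ ≤ B)
    (hV : ∀ n, totalVar Ω (u n) ≤ B) :
    ∃ (w : Euc N → Euc M) (φ : ℕ → ℕ), StrictMono φ ∧ StronglyMeasurable w ∧
      (∀ᵐ x ∂volume.restrict Ω, Tendsto (fun n => u (φ n) x) atTop (𝓝 (w x))) ∧
      Tendsto (fun n => ∫⁻ x in Ω, ‖Metric.infDist x Ωᶜ • (u (φ n) x - w x)‖ₑ) atTop (𝓝 0) := by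
  set d : Euc N → ℝ := fun x => Metric.infDist x Ωᶜ with hd
  have hdc : Continuous d := Metric.continuous_infDist_pt _
  have hd0 : ∀ x ∉ Ω, d x = 0 := fun x hx => Metric.infDist_zero_of_mem hx
  have hdpos : ∀ x ∈ Ω, 0 < d x := fun x hx =>
    (hΩ.isClosed_compl.notMem_iff_infDist_pos hne).1 fun h => h hx
  obtain ⟨R, hR⟩ := hb.subset_closedBall (0 : Euc N)
  obtain ⟨W, hW⟩ : ∃ W : NNReal, ∀ x, d x ≤ W := by
    obtain ⟨z, hz⟩ := hne
    refine ⟨(R + ‖z‖).toNNReal, fun x => ?_⟩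
    by_cases hx : x ∈ Ω
    · refine le_trans ?_ (Real.le_coe_toNNReal _)
      refine (Metric.infDist_le_dist_of_mem hz).trans ((dist_le_norm_add_norm x z).trans ?_)
      have := mem_closedBall_zero_iff.1 (hR hx)
      linarith
    · rw [hd0 x hx]
      exact NNReal.coe_nonneg _
  have hui : ∀ n, Integrable (u n) := fun n =>
    ⟨(hm n).aestronglyMeasurable, (hu n).trans_lt ENNReal.coe_lt_top⟩
  have hvi : ∀ n, Integrable fun x => d x • u n x := fun n =>
    (hui n).bdd_smul (C := W) (φ := d) hdc.aestronglyMeasurable (ae_of_all _ fun x => by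
      rw [Real.norm_of_nonneg Metric.infDist_nonneg]; exact hW x)
  let v : ℕ → Lp (Euc M) 1 (volume : Measure (Euc N)) := fun n => (hvi n).toL1 _
  have hv : ∀ n, v n =ᵐ[volume] fun x => d x • u n x := fun n => (hvi n).coeFn_toL1
  have htb : TotallyBounded (range v) := by
    refine totallyBounded_Lp_one_of_translate (R := R) (B := W * B) (C := W * B + 3 * B) ?_ ?_ ?_
    · rintro _ ⟨n, rfl⟩
      filter_upwards [hv n] with x hx hxR
      rw [hx, hd0 x fun h => hxR (hR h), zero_smul]
    · rintro _ ⟨n, rfl⟩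
      rw [L1.norm_def]
      refine ENNReal.toReal_le_of_le_ofReal (by positivity) ?_
      rw [← NNReal.coe_mul, ENNReal.ofReal_coe_nnreal, ENNReal.coe_mul]
      calc ∫⁻ x, ‖v n x‖ₑ = ∫⁻ x, ‖d x • u n x‖ₑ :=
            lintegral_congr_ae ((hv n).mono fun x hx => by simp only [hx])
        _ ≤ ∫⁻ x, W * ‖u n x‖ₑ := by
            refine lintegral_mono fun x => ?_
            rw [enorm_smul, Real.enorm_of_nonneg Metric.infDist_nonneg]
            gcongr
            rw [← ENNReal.ofReal_coe_nnreal]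
            exact ENNReal.ofReal_le_ofReal (hW x)
        _ = W * ∫⁻ x, ‖u n x‖ₑ := lintegral_const_mul _ (hm n).enorm
        _ ≤ W * B := by gcongr; exact hu n
    · rintro _ ⟨n, rfl⟩ h
      have hvh : (fun x => v n (x + h)) =ᵐ[volume] fun x => d (x + h) • u n (x + h) :=
        (measurePreserving_add_right volume h).quasiMeasurePreserving.ae_eq_comp (hv n)
      calc ∫⁻ x, ‖v n (x + h) - v n x‖ₑ
          = ∫⁻ x, ‖d (x + h) • u n (x + h) - d x • u n x‖ₑ := by
            refine lintegral_congr_ae ?_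
            filter_upwards [hv n, hvh] with x h1 h2
            rw [h1, h2]
        _ ≤ (W * totalVar Ω (u n) + 3 * ∫⁻ x, ‖u n x‖ₑ) * ‖h‖ₑ :=
            lintegral_enorm_infDist_smul_translate_sub_le hW (hm n) (hui n) h
        _ ≤ (W * B + 3 * B) * ‖h‖ₑ := by
            gcongr
            · exact hV n
            · exact hu n
        _ = _ := by push_cast; rfl
  obtain ⟨g, -, φ, hφ, hg⟩ := (isCompact_iff_totallyBounded_isComplete.2
    ⟨htb.closure, isClosed_closure.isComplete⟩).tendsto_subseq
    fun n => subset_closure (mem_range_self (f := v) n)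
  obtain ⟨ψ, hψ, hae⟩ := (tendstoInMeasure_of_tendsto_Lp hg).exists_seq_tendsto_ae
  -- Dividing by the weight recovers the limit on `Ω`, and gives `0` outside since `0⁻¹ = 0`.
  -- Integrability of the quotient is not claimed here.
  refine ⟨fun x => (d x)⁻¹ • g x, φ ∘ ψ, hφ.comp hψ,
    (hdc.measurable.inv.stronglyMeasurable).smul (Lp.stronglyMeasurable g), ?_, ?_⟩
  · have hall : ∀ᵐ x, ∀ n, v n x = d x • u n x := ae_all_iff.2 hv
    rw [ae_restrict_iff' hΩ.measurableSet]
    filter_upwards [hae, hall] with x hx hvx hxΩ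
    refine (hx.const_smul (d x)⁻¹).congr fun n => ?_
    simp only [Function.comp_apply, hvx]
    rw [inv_smul_smul₀ (hdpos x hxΩ).ne']
  · have h1 : Tendsto (fun n => edist (v (φ (ψ n))) g) atTop (𝓝 0) :=
      (tendsto_iff_edist_tendsto_0.1 hg).comp hψ.tendsto_atTop
    refine tendsto_of_tendsto_of_tendsto_of_le_of_le tendsto_const_nhds h1 (fun _ => zero_le)
      fun n => ?_
    simp only [L1.edist_def]
    refine le_trans ?_ (setLIntegral_le_lintegral Ω _)
    refine lintegral_mono_ae ?_
    rw [ae_restrict_iff' hΩ.measurableSet]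
    filter_upwards [hv (φ (ψ n))] with x hx hxΩ
    rw [hx, edist_eq_enorm_sub, smul_sub, smul_inv_smul₀ (hdpos x hxΩ).ne']
    rfl

/-! ### Lower semicontinuity. -/

-- On the compact support of `φ`, inside `Ω`, the distance to the complement is positive, so the
-- continuous quotient is bounded there. This is why weighted convergence suffices for testing.
open Set in
theorem exists_abs_divergence_le_mul_infDist {N : ℕ} {Ω : Set (Euc N)} (hΩ : IsOpen Ω)
    (hne : Ωᶜ.Nonempty) {φ : Euc N → Euc N} (hφ : ContDiff ℝ ∞ φ) (hc : HasCompactSupport φ)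
    (hs : tsupport φ ⊆ Ω) :
    Continuous (divergence φ) ∧ ∃ C, 0 ≤ C ∧ ∀ x, |divergence φ x| ≤ C * Metric.infDist x Ωᶜ := by
  have hcont : Continuous (divergence φ) := by
    have := hφ.continuous_fderiv (by simp)
    unfold divergence
    fun_prop
  have hdpos : ∀ x ∈ Ω, 0 < Metric.infDist x Ωᶜ := fun x hx =>
    (hΩ.isClosed_compl.notMem_iff_infDist_pos hne).1 fun h => h hx
  refine ⟨hcont, ?_⟩
  obtain ⟨C, hC⟩ := hc.isCompact.exists_bound_of_continuousOn
    (f := fun x => divergence φ x / Metric.infDist x Ωᶜ)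
    (hcont.continuousOn.div (Metric.continuous_infDist_pt _).continuousOn
      fun x hx => (hdpos x (hs hx)).ne')
  refine ⟨max C 0, le_max_right _ _, fun x => ?_⟩
  by_cases hx : x ∈ tsupport φ
  · have h1 := hC x hx
    have h2 := hdpos x (hs hx)
    rw [norm_div, Real.norm_of_nonneg h2.le, div_le_iff₀ h2] at h1
    exact h1.trans (mul_le_mul_of_nonneg_right (le_max_left _ _) h2.le)
  · have h0 : fderiv ℝ φ x = 0 :=
      Function.notMem_support.1 fun h => hx (support_fderiv_subset ℝ h)
    simp only [divergence, h0]
    simpa using mul_nonneg (le_max_right C 0) (Metric.infDist_nonneg (x := x) (s := Ωᶜ))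

-- For each fixed test field the integral converges, the weight absorbing the divergence; a supremum
-- of such functionals is lower semicontinuous.
open MeasureTheory Set Filter Topology in
theorem totalVar_le_liminf {N M : ℕ} {Ω : Set (Euc N)} (hΩ : IsOpen Ω) (hne : Ωᶜ.Nonempty)
    {u : ℕ → Euc N → Euc M} {w : Euc N → Euc M} (hu : ∀ n, IntegrableOn (u n) Ω)
    (hw : IntegrableOn w Ω)
    (h : Tendsto (fun n => ∫⁻ x in Ω, ‖Metric.infDist x Ωᶜ • (u n x - w x)‖ₑ) atTop (𝓝 0)) :
    totalVar Ω w ≤ liminf (fun n => totalVar Ω (u n)) atTop := by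
  refine iSup₂_le fun φ hφ => ?_
  choose hcont C hC0 hC using fun i => exists_abs_divergence_le_mul_infDist hΩ hne (hφ.smooth i)
    (hφ.compact_support i) (hφ.support_subset i)
  have hint : ∀ {v : Euc N → Euc M}, IntegrableOn v Ω →
      Integrable (fun x => ∑ i, v x i * divergence (φ i) x) (volume.restrict Ω) := fun {v} hv => by
    refine integrable_finsetSum _ fun i _ => ?_
    have hcs : HasCompactSupport (divergence (φ i)) :=
      HasCompactSupport.intro (hφ.compact_support i) fun x hx => by
        have h0 : fderiv ℝ (φ i) x = 0 :=
          Function.notMem_support.1 fun h => hx (support_fderiv_subset ℝ h)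
        simp [divergence, h0]
    obtain ⟨B, hB⟩ := hcs.exists_bound_of_continuous (hcont i)
    have hvi : Integrable (fun x => v x i) (volume.restrict Ω) :=
      (EuclideanSpace.proj (𝕜 := ℝ) i : Euc M →L[ℝ] ℝ).integrable_comp hv
    exact hvi.mul_bdd (hcont i).aestronglyMeasurable (ae_of_all _ hB)
  have hlim : Tendsto (fun n => ∫ x in Ω, ∑ i, u n x i * divergence (φ i) x) atTop
      (𝓝 (∫ x in Ω, ∑ i, w x i * divergence (φ i) x)) := by
    refine tendsto_integral_of_L1 _ (hint hw).aestronglyMeasurable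
      (Eventually.of_forall fun n => hint (hu n)) ?_
    have h0 : Tendsto (fun n => ENNReal.ofReal (∑ i, C i) *
        ∫⁻ x in Ω, ‖Metric.infDist x Ωᶜ • (u n x - w x)‖ₑ) atTop (𝓝 0) := by
      simpa using ENNReal.Tendsto.const_mul h (Or.inr ENNReal.ofReal_ne_top)
    refine tendsto_of_tendsto_of_tendsto_of_le_of_le tendsto_const_nhds h0 (fun _ => zero_le)
      fun n => ?_
    simp only
    rw [← lintegral_const_mul' _ _ ENNReal.ofReal_ne_top]
    refine lintegral_mono fun x => ?_
    rw [← ofReal_norm, ← ofReal_norm,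
      ← ENNReal.ofReal_mul (Finset.sum_nonneg fun i _ => hC0 i)]
    refine ENNReal.ofReal_le_ofReal ?_
    rw [← Finset.sum_sub_distrib, norm_smul, Finset.sum_mul,
      Real.norm_of_nonneg Metric.infDist_nonneg]
    refine norm_sum_le_of_le _ fun i _ => ?_
    have h1 : |u n x i - w x i| ≤ ‖u n x - w x‖ := by
      simpa using PiLp.norm_apply_le (u n x - w x) i
    rw [← sub_mul, norm_mul, ← mul_assoc, mul_comm]
    exact mul_le_mul (hC i x) h1 (abs_nonneg _) (mul_nonneg (hC0 i) Metric.infDist_nonneg)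
  rw [← ((ENNReal.continuous_ofReal.tendsto _).comp hlim).liminf_eq]
  refine liminf_le_liminf (Eventually.of_forall fun n => ?_)
  exact le_iSup₂ (f := fun (φ : Fin M → Euc N → Euc N) (_ : IsTestField Ω φ) =>
    ENNReal.ofReal (∫ x in Ω, ∑ i, u n x i * divergence (φ i) x)) φ hφ

open MeasureTheory Filter in
theorem totalVar_congr_ae {N M : ℕ} {A : Set (Euc N)} {u v : Euc N → Euc M}
    (h : u =ᵐ[volume.restrict A] v) : totalVar A u = totalVar A v := by
  refine iSup_congr fun φ => iSup_congr fun _ => ?_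
  congr 1
  exact integral_congr_ae (h.mono fun x hx => by simp only [hx])

open MeasureTheory Filter Set in
theorem colorFunctional_congr_ae {N M : ℕ} {Ω D : Set (Euc N)} (hD : D ⊆ Ω) {lam mu p : ℝ}
    {e : Euc M} {L : ℝ → ℝ} {f u v : Euc N → Euc M} (h : u =ᵐ[volume.restrict Ω] v) :
    colorFunctional Ω D lam mu p e L f u = colorFunctional Ω D lam mu p e L f v := by
  unfold colorFunctional
  rw [totalVar_congr_ae h]
  congr 2
  · congr 1
    exact lintegral_congr_ae ((ae_restrict_of_ae_restrict_of_subset sdiff_subset h).mono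
      fun x hx => by simp only [hx])
  · exact lintegral_congr_ae ((ae_restrict_of_ae_restrict_of_subset hD h).mono
      fun x hx => by simp only [hx])

open Filter in
theorem ENNReal.liminf_add_liminf_le (a b : ℕ → ENNReal) :
    liminf a atTop + liminf b atTop ≤ liminf (fun n => a n + b n) atTop := by
  simp only [liminf_eq_iSup_iInf_of_nat]
  rw [ENNReal.iSup_add_iSup_of_monotone]
  · refine iSup_mono fun n => le_iInf₂ fun i hi => ?_
    exact add_le_add (iInf₂_le i hi) (iInf₂_le i hi)
  · exact fun m n hmn => le_iInf₂ fun i hi => iInf₂_le i (hmn.trans hi)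
  · exact fun m n hmn => le_iInf₂ fun i hi => iInf₂_le i (hmn.trans hi)

open Filter in
theorem ENNReal.mul_liminf_le (c : ENNReal) (a : ℕ → ENNReal) :
    c * liminf a atTop ≤ liminf (fun n => c * a n) atTop := by
  simp only [liminf_eq_iSup_iInf_of_nat]
  rw [ENNReal.mul_iSup]
  refine iSup_mono fun n => le_iInf₂ fun i hi => ?_
  gcongr
  exact iInf₂_le i hi

open MeasureTheory Filter Topology in
theorem lintegral_enorm_rpow_le_liminf {α E : Type*} [MeasurableSpace α] {μ : Measure α}
    [NormedAddCommGroup E] {g : ℕ → α → E} {g' : α → E}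
    (hm : ∀ n, AEStronglyMeasurable (g n) μ)
    (h : ∀ᵐ x ∂μ, Tendsto (fun n => g n x) atTop (𝓝 (g' x))) (p : ℝ) :
    ∫⁻ x, ‖g' x‖ₑ ^ p ∂μ ≤ liminf (fun n => ∫⁻ x, ‖g n x‖ₑ ^ p ∂μ) atTop := by
  refine le_trans (lintegral_mono_ae ?_)
    (lintegral_liminf_le' fun n => (hm n).enorm.pow_const p)
  filter_upwards [h] with x hx
  exact ((ENNReal.continuous_rpow_const.tendsto _).comp
    ((continuous_enorm.tendsto _).comp hx)).liminf_eq.ge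

open MeasureTheory Filter Topology Set in
/-- Lower semicontinuity of the functional under the convergence given by compactness. -/
theorem colorFunctional_le_liminf {N M : ℕ} {Ω D : Set (Euc N)} (hΩ : IsOpen Ω)
    (hne : Ωᶜ.Nonempty) (hD : D ⊆ Ω) {lam mu p : ℝ} {e : Euc M} {L : ℝ → ℝ} (hL : Continuous L)
    {f : Euc N → Euc M} (hf : AEStronglyMeasurable f (volume.restrict Ω))
    {u : ℕ → Euc N → Euc M} {w : Euc N → Euc M} (hu : ∀ n, IntegrableOn (u n) Ω)
    (hw : IntegrableOn w Ω)
    (hae : ∀ᵐ x ∂volume.restrict Ω, Tendsto (fun n => u n x) atTop (𝓝 (w x)))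
    (h : Tendsto (fun n => ∫⁻ x in Ω, ‖Metric.infDist x Ωᶜ • (u n x - w x)‖ₑ) atTop (𝓝 0)) :
    colorFunctional Ω D lam mu p e L f w
      ≤ liminf (fun n => colorFunctional Ω D lam mu p e L f (u n)) atTop := by
  have hr : ∀ {S : Set (Euc N)}, S ⊆ Ω → volume.restrict S ≤ volume.restrict Ω :=
    fun hS => Measure.restrict_mono hS le_rfl
  have h1 : ∫⁻ x in Ω \ D, ‖w x - f x‖ₑ ^ p
      ≤ liminf (fun n => ∫⁻ x in Ω \ D, ‖u n x - f x‖ₑ ^ p) atTop := by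
    refine lintegral_enorm_rpow_le_liminf (fun n =>
      ((hu n).aestronglyMeasurable.sub hf).mono_measure (hr sdiff_subset)) ?_ p
    filter_upwards [ae_restrict_of_ae_restrict_of_subset sdiff_subset hae] with x hx
    exact hx.sub_const _
  have h2 : ∫⁻ x in D, ‖L (inner ℝ (w x) e) - L (inner ℝ (f x) e)‖ₑ ^ p
      ≤ liminf (fun n => ∫⁻ x in D, ‖L (inner ℝ (u n x) e) - L (inner ℝ (f x) e)‖ₑ ^ p)
        atTop := by
    have hLe : Continuous fun y : Euc M => L (inner ℝ y e) := hL.comp (by fun_prop)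
    refine lintegral_enorm_rpow_le_liminf (fun n =>
      ((hLe.comp_aestronglyMeasurable (hu n).aestronglyMeasurable).sub
        (hLe.comp_aestronglyMeasurable hf)).mono_measure (hr hD)) ?_ p
    filter_upwards [ae_restrict_of_ae_restrict_of_subset hD hae] with x hx
    exact ((hLe.tendsto _).comp hx).sub_const _
  unfold colorFunctional
  refine le_trans ?_ (ENNReal.liminf_add_liminf_le _ _)
  refine add_le_add (le_trans (add_le_add (totalVar_le_liminf hΩ hne hu hw h) ?_)
    (ENNReal.liminf_add_liminf_le _ _)) ?_
  · exact (mul_le_mul_right h1 _).trans (ENNReal.mul_liminf_le _ _)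
  · exact (mul_le_mul_right h2 _).trans (ENNReal.mul_liminf_le _ _)

/-! ### Coercivity and existence of a minimizer. -/

-- Uses `t ≤ 1 + t ^ p` for `p ≥ 1`, applied to `|u - f|`. With `S = Ω \ D`, it turns the fidelity
-- term into the input of the Poincaré inequality.
open MeasureTheory Set in
theorem setLIntegral_enorm_le_of_rpow {N M : ℕ} {Ω S : Set (Euc N)} (hS : S ⊆ Ω) {p : ℝ}
    (hp : 1 ≤ p) {f u : Euc N → Euc M} (hf : AEStronglyMeasurable f (volume.restrict Ω)) :
    ∫⁻ x in S, ‖u x‖ₑ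
      ≤ volume Ω + (∫⁻ x in S, ‖u x - f x‖ₑ ^ p) + ∫⁻ x in Ω, ‖f x‖ₑ := by
  have hpt : ∀ t : ENNReal, t ≤ 1 + t ^ p := fun t => by
    rcases le_total t 1 with ht | ht
    · exact ht.trans le_self_add
    · exact (ENNReal.le_rpow_self_of_one_le ht hp).trans le_add_self
  calc ∫⁻ x in S, ‖u x‖ₑ ≤ ∫⁻ x in S, ((1 + ‖u x - f x‖ₑ ^ p) + ‖f x‖ₑ) := by
        refine lintegral_mono fun x => ?_
        calc ‖u x‖ₑ = ‖(u x - f x) + f x‖ₑ := by rw [sub_add_cancel]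
          _ ≤ _ := (enorm_add_le _ _).trans (add_le_add_left (hpt _) _)
    _ = volume S + (∫⁻ x in S, ‖u x - f x‖ₑ ^ p) + ∫⁻ x in S, ‖f x‖ₑ := by
        rw [lintegral_add_right' _ (hf.mono_set hS).enorm, lintegral_add_left measurable_const,
          setLIntegral_one]
    _ ≤ _ := add_le_add (add_le_add_left (measure_mono hS) _) (lintegral_mono_set hS)

open MeasureTheory Filter Topology Set in
theorem mainTheorem4 {N M : ℕ} (Ω D : Set (Euc N))
    (hΩ_open : IsOpen Ω) (hΩ_bdd : Bornology.IsBounded Ω) (hΩ_conn : IsConnected Ω)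
    (hΩ_lip : HasLipschitzBoundary Ω)
    (hD_meas : MeasurableSet D) (hD_sub : D ⊆ Ω) (hD_int : (interior D).Nonempty)
    (hD_compl : 0 < MeasureTheory.volume (Ω \ D))
    (lam mu p : ℝ) (hlam : 0 < lam) (hmu : 0 < mu) (hp : 1 ≤ p)
    (e : Euc M) (he : ‖e‖ = 1)
    (L : ℝ → ℝ) (hL : Continuous L)
    (f : Euc N → Euc M)
    (hf : MeasureTheory.MemLp f (ENNReal.ofReal p) (MeasureTheory.volume.restrict Ω)) :
    ∃ u : Euc N → Euc M, IsBV Ω u ∧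
      ∀ v : Euc N → Euc M, IsBV Ω v →
        colorFunctional Ω D lam mu p e L f u ≤ colorFunctional Ω D lam mu p e L f v := by
  set F : (Euc N → Euc M) → ENNReal := colorFunctional Ω D lam mu p e L f
  by_cases hfin : ∃ v, IsBV Ω v ∧ F v < ⊤
  swap
  · refine ⟨0, ⟨integrableOn_zero, ?_⟩, fun v hv => ?_⟩
    · simp [totalVar]
    · have : F v = ⊤ := not_lt_top_iff.1 fun h => hfin ⟨v, hv, h⟩
      rw [this]
      exact le_top
  obtain ⟨v₀, hv₀, hv₀F⟩ := hfin
  -- Two distinct points, one in `D` and one in `Ω \ D`, rule out `N = 0`; a bounded set is then not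
  -- the whole space.
  have hne : Ωᶜ.Nonempty := by
    obtain ⟨x, hx⟩ := hD_int
    obtain ⟨y, hy⟩ := nonempty_of_measure_ne_zero hD_compl.ne'
    have hxy : x ≠ y := fun h => hy.2 (h ▸ interior_subset hx)
    have : Nontrivial (Euc N) := ⟨x, y, hxy⟩
    refine nonempty_compl.2 fun h => ?_
    exact NormedSpace.unbounded_univ ℝ (Euc N) (h ▸ hΩ_bdd)
  have hfin_vol : volume Ω < ⊤ := hΩ_bdd.measure_lt_top
  have : IsFiniteMeasure (volume.restrict Ω) := ⟨by simpa using hfin_vol⟩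
  have hf1 : ∫⁻ x in Ω, ‖f x‖ₑ < ⊤ :=
    (hf.integrable (by simpa using ENNReal.ofReal_le_ofReal hp)).2
  obtain ⟨C, hC⟩ := exists_setLIntegral_enorm_le M hΩ_open hΩ_bdd hΩ_conn.isPreconnected hΩ_lip
    sdiff_subset hD_compl
  -- Restricting to the sublevel set of `v₀` bounds every term of the minimizing sequence by `F v₀ <
  -- ⊤`.
  obtain ⟨y, -, hy, hyS⟩ := exists_seq_tendsto_sInf
    (S := F '' {v | IsBV Ω v ∧ F v ≤ F v₀}) ⟨F v₀, v₀, ⟨hv₀, le_rfl⟩, rfl⟩ (OrderBot.bddBelow _)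
  choose v hv hvy using hyS
  -- Strongly measurable representatives, cut off outside `Ω` to be integrable on the whole space;
  -- `F` does not see the change.
  let u : ℕ → Euc N → Euc M := fun n => Ω.indicator ((hv n).1.1.aestronglyMeasurable.mk (v n))
  have huv : ∀ n, u n =ᵐ[volume.restrict Ω] v n := fun n =>
    (indicator_ae_eq_restrict hΩ_open.measurableSet).trans
      (hv n).1.1.aestronglyMeasurable.ae_eq_mk.symm
  have hum : ∀ n, StronglyMeasurable (u n) := fun n =>
    (hv n).1.1.aestronglyMeasurable.stronglyMeasurable_mk.indicator hΩ_open.measurableSet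
  have huΩ : ∀ n, IntegrableOn (u n) Ω := fun n => (hv n).1.1.congr (huv n).symm
  have hui : ∀ n, Integrable (u n) := fun n =>
    (integrableOn_iff_integrable_of_support_subset support_indicator_subset).1 (huΩ n)
  have hFu : ∀ n, F (u n) = y n := fun n => by
    rw [← hvy n]
    exact colorFunctional_congr_ae hD_sub (huv n)
  have hFle : ∀ n, F (u n) ≤ F v₀ := fun n => by
    rw [hFu, ← hvy n]
    exact (hv n).2
  have hTV : ∀ n, totalVar Ω (u n) ≤ F v₀ := fun n =>
    (le_self_add.trans le_self_add).trans (hFle n)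
  have hlam0 : ENNReal.ofReal lam ≠ 0 := by simpa using hlam
  have hout : ∀ n, ∫⁻ x in Ω \ D, ‖u n x - f x‖ₑ ^ p ≤ F v₀ / ENNReal.ofReal lam := fun n => by
    rw [ENNReal.le_div_iff_mul_le (Or.inl hlam0) (Or.inl ENNReal.ofReal_ne_top), mul_comm]
    exact (le_add_self.trans le_self_add).trans (hFle n)
  set B : ENNReal := C * ((volume Ω + F v₀ / ENNReal.ofReal lam + ∫⁻ x in Ω, ‖f x‖ₑ) + F v₀)
  have hBt : B ≠ ⊤ := by
    refine ENNReal.mul_ne_top ENNReal.coe_ne_top ?_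
    simp only [ne_eq, ENNReal.add_eq_top, not_or]
    exact ⟨⟨⟨hfin_vol.ne, ENNReal.div_ne_top hv₀F.ne hlam0⟩, hf1.ne⟩, hv₀F.ne⟩
  have huB : ∀ n, ∫⁻ x in Ω, ‖u n x‖ₑ ≤ B := fun n => by
    refine (hC (u n) (hum n) (hui n)).trans ?_
    refine mul_le_mul_right (add_le_add ?_ (hTV n)) _
    exact (setLIntegral_enorm_le_of_rpow sdiff_subset hp hf.1).trans
      (add_le_add_left (add_le_add_right (hout n) _) _)
  have huB' : ∀ n, ∫⁻ x, ‖u n x‖ₑ ≤ B := fun n => by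
    refine le_of_eq_of_le ?_ (huB n)
    rw [← lintegral_indicator hΩ_open.measurableSet]
    refine lintegral_congr fun x => ?_
    by_cases hx : x ∈ Ω <;> simp [u, hx]
  have hmax : ((B + F v₀).toNNReal : ENNReal) = B + F v₀ :=
    ENNReal.coe_toNNReal (ENNReal.add_ne_top.2 ⟨hBt, hv₀F.ne⟩)
  obtain ⟨w, φ, hφ, hwm, hae, hw⟩ := exists_subseq_tendsto_of_totalVar_le hΩ_open hΩ_bdd hne hum
    (B := (B + F v₀).toNNReal) (fun n => by rw [hmax]; exact (huB' n).trans le_self_add)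
    (fun n => by rw [hmax]; exact (hTV n).trans le_add_self)
  -- Compactness gave only weighted convergence, so integrability comes from Fatou's lemma with
  -- exponent `1`.
  have hwi : IntegrableOn w Ω := by
    refine ⟨hwm.aestronglyMeasurable, lt_of_le_of_lt ?_ hBt.lt_top⟩
    have := lintegral_enorm_rpow_le_liminf
      (fun n => (hum (φ n)).aestronglyMeasurable (μ := volume.restrict Ω)) hae 1
    simp only [ENNReal.rpow_one] at this
    refine this.trans ((liminf_le_liminf (Eventually.of_forall fun n => huB (φ n))).trans ?_)
    simp
  have hFw : F w ≤ sInf (F '' {v | IsBV Ω v ∧ F v ≤ F v₀}) := by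
    rw [← (hy.comp hφ.tendsto_atTop).liminf_eq]
    refine (colorFunctional_le_liminf hΩ_open hne hD_sub hL hf.1 (fun n => huΩ (φ n)) hwi hae
      hw).trans_eq ?_
    exact congrArg (fun s => liminf s atTop) (funext fun n => hFu (φ n))
  have hwv₀ : F w ≤ F v₀ := hFw.trans (sInf_le ⟨v₀, ⟨hv₀, le_rfl⟩, rfl⟩)
  refine ⟨w, ⟨hwi, (le_self_add.trans le_self_add).trans_lt (hwv₀.trans_lt hv₀F)⟩,
    fun v' hv' => ?_⟩
  rcases le_total (F v') (F v₀) with h | h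
  · exact hFw.trans (sInf_le ⟨v', ⟨hv', h⟩, rfl⟩)
  · exact hwv₀.trans h
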